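/- Let $k$ be an algebraically closed field of characteristic zero, $n$ a positive integer with $4\mid n$, $q\in k$ a primitive $n^2$-th root of unity and $\mathfrak q=q^n$. Let $u=\mathbf{Q}u_q(\mathfrak{sl}_2)$ be the associative $k$-algebra generated by $\kappa,\hat\kappa,E,F$ with relations $$\kappa^n=1,\quad \hat\kappa^n=\kappa^{-2},\quad \kappa\hat\kappa=\hat\kappa\kappa,\quad \kappa E\kappa^{-1}=\mathfrak qE,\quad \kappa F\kappa^{-1}=\mathfrak q^{-1}F,\quad \hat\kappa E\hat\kappa^{-1}=\mathfrak qq^{-2}E,\quad \hat\kappa F\hat\kappa^{-1}=\mathfrak q^{-1}q^{2}F,$$ $$E^{n^2}=F^{n^2}=0,\qquad FE-q^{-1}EF=1-\kappa^{-1}\hat\kappa .$$ Let $u^0$ and $u^+$ be the subalgebras generated by $\{\kappa,\hat\kappa\}$ and by $E$. For $1\le i\le n^2/2$ and $j\in\{0,1\}$ put $$e_{2i,j}=\Big(\frac{2}{n^2}\sum_{t=0}^{n^2/2-1}q^{-2it}(\kappa^{-1}\hat\kappa)^t\Big)\cdot\frac12\big(1+(-1)^j\kappa\hat\kappa^{n/2}\big),\qquad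 \beta_{2i,j}=E^{2i-2}F^{n^2-1}e_{2i,j}.$$ **Theorem.** For all $1\le i\le n^2/2$ and $j\in\{0,1\}$ there is a unique vector $\gamma_{2i,j}\in\sum_{a=0}^{n^2-2}F^a u^0u^+$ with $F\gamma_{2i,j}=\beta_{2i,j}$. Let $P_{2i,j}=u\gamma_{2i,j}$, a left ideal of $u$, and let $S_{2i,j}$ be its socle (the sum of its simple submodules). Then $\dim_k P_{2i,j}=2n^2$, the module $S_{2i,j}$ is simple, and, as a left $u$-module, $u$ is the (internal) direct sum $$u=\bigoplus_{j=0}^{1}\ \bigoplus_{i=1}^{n^2/2}\ \bigoplus_{h=0}^{n^2-2i}P_{2i,j}E^h .$$ -/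

import Mathlib

namespace QuasiSl2

/-- The four algebra generators. -/
inductive Gen : Type
  | k
  | kh
  | E
  | F

section FreeGenerators

variable (K : Type*) [Field K]

/-- The letters in the free algebra. -/
abbrev fk : FreeAlgebra K Gen := FreeAlgebra.ι K Gen.k
abbrev fkh : FreeAlgebra K Gen := FreeAlgebra.ι K Gen.kh
abbrev fE : FreeAlgebra K Gen := FreeAlgebra.ι K Gen.E
abbrev fF : FreeAlgebra K Gen := FreeAlgebra.ι K Gen.F

end FreeGenerators

/-- The defining relations. As `k ^ n = 1`, the inverse of `k` is written `k ^ (n - 1)`; the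
generator `kh` is invertible too, and the conjugation relations `g x g⁻¹ = c x` are written
`g x = c x g`. -/
inductive Rel {K : Type*} [Field K] (n : ℕ) (q : K) : FreeAlgebra K Gen → FreeAlgebra K Gen → Prop
  | k_pow : Rel n q (fk K ^ n) 1
  | kh_pow : Rel n q (fkh K ^ n) ((fk K ^ (n - 1)) ^ 2)
  | k_kh : Rel n q (fk K * fkh K) (fkh K * fk K)
  | k_E : Rel n q (fk K * fE K) (q ^ n • (fE K * fk K))
  | k_F : Rel n q (fk K * fF K) ((q ^ n)⁻¹ • (fF K * fk K))
  | kh_E : Rel n q (fkh K * fE K) ((q ^ n * (q ^ 2)⁻¹) • (fE K * fkh K))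
  | kh_F : Rel n q (fkh K * fF K) (((q ^ n)⁻¹ * q ^ 2) • (fF K * fkh K))
  | E_pow : Rel n q (fE K ^ (n ^ 2)) 0
  | F_pow : Rel n q (fF K ^ (n ^ 2)) 0
  | F_E : Rel n q (fF K * fE K - q⁻¹ • (fE K * fF K)) (1 - fk K ^ (n - 1) * fkh K)

/-- The associative algebra underlying the quasi-Frobenius-Lusztig kernel of `sl₂`. -/
abbrev U {K : Type*} [Field K] (n : ℕ) (q : K) : Type _ := RingQuot (Rel n q)

section Elements

variable {K : Type*} [Field K] (n : ℕ) (q : K)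

/-- The images of the generators in the algebra. -/
def k : U n q := RingQuot.mkAlgHom K (Rel n q) (fk K)
def kh : U n q := RingQuot.mkAlgHom K (Rel n q) (fkh K)
def E : U n q := RingQuot.mkAlgHom K (Rel n q) (fE K)
def F : U n q := RingQuot.mkAlgHom K (Rel n q) (fF K)

/-- The inverse of `k`, see `k_mul_kInv` and `kInv_mul_k`. -/
def kInv : U n q := k n q ^ (n - 1)

theorem k_pow : k n q ^ n = 1 := by
  simpa [k] using RingQuot.mkAlgHom_rel K (Rel.k_pow (n := n) (q := q))

theorem k_mul_kInv (hn : 0 < n) : k n q * kInv n q = 1 := by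
  rw [kInv, ← pow_succ', Nat.sub_add_cancel hn, k_pow]

theorem kInv_mul_k (hn : 0 < n) : kInv n q * k n q = 1 := by
  rw [kInv, ← pow_succ, Nat.sub_add_cancel hn, k_pow]

/-- The subalgebra generated by `k` and `kh`. -/
def uZero : Subalgebra K (U n q) := Algebra.adjoin K {k n q, kh n q}

/-- The subalgebra generated by `E`. -/
def uPlus : Subalgebra K (U n q) := Algebra.adjoin K {E n q}

/-- `φ_{2i} = (1 / (m n)) ∑_{t < m n} q^{-2 i t} (k⁻¹ kh)^t`, with `m = n / 2`. -/
def phi (i : ℕ) : U n q :=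
  ((n / 2 * n : ℕ) : K)⁻¹ •
    ∑ t ∈ Finset.range (n / 2 * n), (q⁻¹ ^ (2 * i * t)) • (kInv n q * kh n q) ^ t

/-- `(1 + (-1)^j k kh^{n/2}) / 2`. -/
def sgnIdem (j : Fin 2) : U n q :=
  (2 : K)⁻¹ • (1 + ((-1 : K) ^ (j : ℕ)) • (k n q * kh n q ^ (n / 2)))

/-- The idempotent `e_{2i,j}`. -/
def e (i : ℕ) (j : Fin 2) : U n q := phi n q i * sgnIdem n q j

/-- `α_{2i,j} = F^{n²-1} e_{2i,j}`. -/
def alpha (i : ℕ) (j : Fin 2) : U n q := F n q ^ (n ^ 2 - 1) * e n q i j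

/-- `β_{2i,j} = E^{2i-2} α_{2i,j}`. -/
def beta (i : ℕ) (j : Fin 2) : U n q := E n q ^ (2 * i - 2) * alpha n q i j

/-- The span of the products `F^a y z` with `a ≤ n² - 2`, `y ∈ u⁰` and `z ∈ u⁺`: the part of
`u = u⁻ u⁰ u⁺` (with `u⁻` generated by `F`) in which `F^{n²-1}` does not occur. -/
def lowerPart : Submodule K (U n q) :=
  Submodule.span K
    {x | ∃ a : ℕ, a ≤ n ^ 2 - 2 ∧ ∃ y ∈ uZero n q, ∃ z ∈ uPlus n q, x = F n q ^ a * y * z}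

/-- `g` is the vector `γ_{2i,j}`: it lies in the part of `u⁻ u⁰ u⁺` without `F^{n²-1}`, and
`F g = β_{2i,j}`. -/
def IsGamma (i : ℕ) (j : Fin 2) (g : U n q) : Prop :=
  g ∈ lowerPart n q ∧ F n q * g = beta n q i j

/-- The left ideal `P = u g`. -/
def leftIdeal (g : U n q) : Submodule (U n q) (U n q) := Submodule.span (U n q) {g}

/-- The right translate `P x` of a left ideal `P`, the image of `P` under the left module map
`y ↦ y x`. -/
def rightTranslate (P : Submodule (U n q) (U n q)) (x : U n q) : Submodule (U n q) (U n q) :=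
  P.map (LinearMap.toSpanSingleton (U n q) (U n q) x)

end Elements

/-- The socle of a submodule `P` of `M`, as a submodule of `M`: the sum of the simple submodules
of `P`. -/
def socle {R M : Type*} [Ring R] [AddCommGroup M] [Module R M] (P : Submodule R M) :
    Submodule R M :=
  sSup {S | IsSimpleModule R S ∧ S ≤ P}

/-- The triples `(i, j, h)` with `1 ≤ i ≤ n² / 2`, `j ∈ {0, 1}` and `0 ≤ h ≤ n² - 2 i`. -/
abbrev Index (n : ℕ) : Type :=
  {t : ℕ × Fin 2 × ℕ // (1 ≤ t.1 ∧ t.1 ≤ n ^ 2 / 2) ∧ t.2.2 ≤ n ^ 2 - 2 * t.1}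

end QuasiSl2

/-!
Put `N = n ^ 2`, `κ = k⁻¹ kh` and `s = k kh ^ (n / 2)`. As `4 ∣ n`, the group algebra `u⁰` is
generated by `κ`, of order `N / 2`, and the involution `s`; the `e i j` are its primitive
idempotents. In these terms `u` is given by `κ E = q⁻² E κ`, `κ F = q² F κ`, the anticommutation of
`s` with `E` and `F`, and `F E - q⁻¹ E F = 1 - κ`.

*Triangular basis.* The vectors `F ^ a * e i j * E ^ b` with `a, b < N` form a basis of `u`
(`linearIndependent_pbw`, `span_range_pbw`). Independence is read off from the modules induced from
the characters of `u⁰`, constructed in `indRep`. So `u` is free over `K[F] / (F ^ N)`, with `u⁰u⁺`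
as a space of generators: `F` is injective on `lowerPart` (`eq_zero_of_mem_lowerPart`), and whatever
`F ^ (N - 1)` kills lies in `F u` (`exists_F_mul_of_pow_mul_eq_zero`). Existence and uniqueness of
`γ` follow, because `β` has no component free of `F`.

*The modules `u γ`.* With `α = F ^ (N - 1) e`, the vectors `E ^ a γ` and `E ^ a α` span `u γ`. The
commutation rule for `F` and powers of `E` gives two chains for `F` of length `N`: one goes from
`E ^ (N - 2 i) γ` down to `α`, the other from `E ^ (N - 1) γ` down to `ω = E ^ (2 i - 1) α`. As `α`
and `ω` are independent, the chains form a basis of `u γ`, and the kernel of `F` on `u γ` is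
spanned by `α` and `ω` (`finrank_leftIdeal`, `exists_of_mem_leftIdeal_of_F_mul_eq_zero`). Each
nonzero submodule of `u γ` meets this kernel, and from there one reaches `ω`; so `u ω` is the only
simple submodule (`socle_generator_mem`).

*The decomposition.* In the triangular basis, `α E ^ h` is `F ^ (N - 1) e i j E ^ h`, and `ω E ^ h`
is a multiple of `F ^ (N - 1) e l (j + 1) E ^ (2 i - 1 + h)` with `l = N / 2 + 1 - i`. For
`0 ≤ h ≤ N - 2 i` these exhaust the basis of `F ^ (N - 1) u`, so the sum `M` of all `P E ^ h`
satisfies `F ^ (N - 1) M = F ^ (N - 1) u`, hence `M + F u = u`, and `M = u` as `F` is nilpotent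
(`iSup_summand_eq_top`). There are `N ^ 2 / 2` summands, each of dimension at most `2 N`, and
`u` has dimension `N ^ 3`; so the sum is direct.
-/

namespace QuasiSl2

/-! ### Quantum integers and commutation of powers -/

/-- The `p`-integer `1 + p + ⋯ + p ^ (a - 1)`. -/
def qInt {K : Type*} [Field K] (p : K) (a : ℕ) : K := ∑ b ∈ Finset.range a, p ^ b

section QInt

variable {K : Type*} [Field K] {p : K}

@[simp] theorem qInt_zero : qInt p 0 = 0 := by simp [qInt]

theorem qInt_succ (a : ℕ) : qInt p (a + 1) = qInt p a + p ^ a := Finset.sum_range_succ _ _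

theorem qInt_succ' (a : ℕ) : qInt p (a + 1) = p * qInt p a + 1 := by
  rw [qInt, qInt, Finset.sum_range_succ', Finset.mul_sum]
  simp [pow_succ']

theorem qInt_mul (a : ℕ) : qInt p a * (p - 1) = p ^ a - 1 := geom_sum_mul p a

theorem qInt_eq_zero {N : ℕ} (hp : IsPrimitiveRoot p N) (hN : 1 < N) : qInt p N = 0 :=
  hp.geom_sum_eq_zero hN

theorem qInt_ne_zero {N a : ℕ} (hp : IsPrimitiveRoot p N) (ha : 0 < a) (haN : a < N) :
    qInt p a ≠ 0 := by
  intro h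
  have h1 := qInt_mul (p := p) a
  rw [h, zero_mul] at h1
  exact hp.pow_ne_one_of_pos_of_lt ha.ne' haN (sub_eq_zero.1 h1.symm)

end QInt

section Commutation

variable {K A : Type*} [Field K] [Ring A] [Algebra K A] {q : K} {x y κ : A}

/-- In an algebra with the relations of the generators `E`, `F` and `κ = k⁻¹ kh`, moving `F` past
a power of `E` costs a single term of lower degree. -/
theorem mul_pow_succ_of_rel (h : y * x = q⁻¹ • (x * y) + (1 - κ))
    (hκ : κ * x = (q ^ 2)⁻¹ • (x * κ)) (a : ℕ) :
    y * x ^ (a + 1) = q⁻¹ ^ (a + 1) • (x ^ (a + 1) * y) +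
      qInt q⁻¹ (a + 1) • (x ^ a * (1 - q⁻¹ ^ a • κ)) := by
  induction a with
  | zero => simp [qInt, h]
  | succ a ih =>
    have h1 : x ^ (a + 1) * y * x = q⁻¹ • (x ^ (a + 2) * y) + x ^ (a + 1) - x ^ (a + 1) * κ := by
      rw [mul_assoc, h, mul_add, mul_smul_comm, ← mul_assoc, ← pow_succ]
      noncomm_ring
    have h2 : x ^ a * (1 - q⁻¹ ^ a • κ) * x
        = x ^ (a + 1) - (q⁻¹ ^ a * (q ^ 2)⁻¹) • (x ^ (a + 1) * κ) := by
      rw [mul_assoc, sub_mul, smul_mul_assoc, hκ, one_mul, mul_sub, ← pow_succ, smul_smul,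
        mul_smul_comm, ← mul_assoc, ← pow_succ]
    rw [pow_succ x (a + 1), ← mul_assoc, ih, add_mul, smul_mul_assoc, smul_mul_assoc, h1, h2,
      ← pow_succ x (a + 1), mul_sub, mul_one, mul_smul_comm]
    match_scalars
    · ring
    · rw [qInt_succ (a + 1)]; ring
    · rw [qInt_succ' (a + 1)]; ring

end Commutation

/-! ### Nilpotent endomorphisms and direct sums -/

section Nilpotent

variable {K V : Type*} [Field K] [AddCommGroup V] [Module K V]

/-- If `T ^ N = 0` and `T ^ (N - 1)` is injective on `W`, then the translates `T ^ r W`, `r < N`,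
are independent, and `T ^ s` kills only the last `s` of them. -/
theorem eq_zero_of_pow_sum_eq_zero {T : Module.End K V} {N : ℕ} (hT : T ^ N = 0)
    {W : Submodule K V} (hW : ∀ w ∈ W, (T ^ (N - 1)) w = 0 → w = 0) {y : ℕ → V}
    (hy : ∀ r, y r ∈ W) {s : ℕ} (h : (T ^ s) (∑ r ∈ Finset.range N, (T ^ r) (y r)) = 0) {r : ℕ}
    (hr : r + s < N) : y r = 0 := by
  induction r using Nat.strong_induction_on with
  | _ r ih =>
    refine hW _ (hy r) ?_
    have h1 := congrArg (T ^ (N - 1 - r - s)) h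
    rw [← Module.End.mul_apply, ← pow_add, map_sum, map_zero, Finset.sum_eq_single r] at h1
    · rw [← Module.End.mul_apply, ← pow_add] at h1
      rwa [show N - 1 - r - s + s + r = N - 1 by omega] at h1
    · intro t ht htr
      rcases lt_or_gt_of_ne htr with h2 | h2
      · rw [ih t h2 (by omega), map_zero, map_zero]
      · rw [← Module.End.mul_apply, ← pow_add,
          show N - 1 - r - s + s + t = N + (t - r - 1) by omega, pow_add, hT, zero_mul]
        rfl
    · intro h2
      exact absurd (Finset.mem_range.2 (by omega)) h2

end Nilpotent

section JordanChains

variable {K V ι : Type*} [Field K] [AddCommGroup V] [Module K V] [Fintype ι]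

/-- Jordan chains: if `T ^ N = 0` and the vectors `T ^ (N - 1) x` are linearly independent, then so
are all `T ^ r x` with `r < N` (the case `s = 0`), and a combination of them that `T ^ s` kills
involves only exponents `r ≥ N - s`. -/
theorem coeff_eq_zero_of_chains {T : Module.End K V} {N : ℕ} (hT : T ^ N = 0) {x : ι → V}
    (hx : LinearIndependent K fun t => (T ^ (N - 1)) (x t)) {s : ℕ} {c : Fin N × ι → K}
    (hc : (T ^ s) (∑ p, c p • (T ^ (p.1 : ℕ)) (x p.2)) = 0) {p : Fin N × ι}
    (hp : (p.1 : ℕ) + s < N) : c p = 0 := by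
  rw [Fintype.linearIndependent_iff] at hx
  let y : ℕ → V := fun r => if hr : r < N then ∑ t, c (⟨r, hr⟩, t) • x t else 0
  have hy : ∀ r (hr : r < N), y r = ∑ t, c (⟨r, hr⟩, t) • x t := fun r hr => dif_pos hr
  have h1 : ∑ p, c p • (T ^ (p.1 : ℕ)) (x p.2) = ∑ r ∈ Finset.range N, (T ^ r) (y r) := by
    rw [Fintype.sum_prod_type, Finset.sum_range]
    refine Finset.sum_congr rfl fun r _ => ?_
    rw [hy r r.2, map_sum]
    simp only [map_smul, Fin.eta]
  have h2 : y p.1 = 0 := by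
    refine eq_zero_of_pow_sum_eq_zero hT (W := Submodule.span K (Set.range x)) ?_ ?_ (s := s)
      (by rw [← h1, hc]) hp
    · intro w hw hw0
      obtain ⟨d, rfl⟩ := (Submodule.mem_span_range_iff_exists_fun K).1 hw
      rw [map_sum] at hw0
      simp only [map_smul] at hw0
      simp [hx d hw0]
    · intro r
      by_cases hr : r < N
      · rw [hy r hr]
        exact sum_mem fun t _ => Submodule.smul_mem _ _ (Submodule.subset_span ⟨t, rfl⟩)
      · simp only [y, dif_neg hr]
        exact zero_mem _
  rw [hy p.1 p.1.2] at h2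
  have h3 := congrArg (T ^ (N - 1)) h2
  rw [map_sum, map_zero] at h3
  simp only [map_smul] at h3
  exact hx (fun t => c (p.1, t)) h3 p.2

end JordanChains

section Internal

variable {K R M ι : Type*} [Field K] [Ring R] [Algebra K R] [AddCommGroup M] [Module K M]
  [Module R M] [IsScalarTower K R M] [Module.Finite K M] [Fintype ι] [DecidableEq ι]

/-- Submodules that span `M` are independent if their dimensions add up to at most that of `M`. -/
theorem isInternal_of_sum_finrank_le {A : ι → Submodule R M} (hA : ⨆ t, A t = ⊤)
    (hle : ∑ t, Module.finrank K (A t) ≤ Module.finrank K M) : DirectSum.IsInternal A := by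
  have hsurj : Function.Surjective (DirectSum.coeLinearMap A) := by
    rw [← LinearMap.range_eq_top, DirectSum.range_coeLinearMap, hA]
  let B : ι → Submodule K M := fun t => (A t).restrictScalars K
  have hsurj' : Function.Surjective (DirectSum.coeLinearMap B) := hsurj
  have hle' : Module.finrank K (DirectSum ι fun t => B t) ≤ Module.finrank K M := by
    rw [Module.finrank_directSum]
    exact hle
  have hinj : Function.Injective (DirectSum.coeLinearMap B) :=
    (LinearMap.injective_iff_surjective_of_finrank_eq_finrank (le_antisymm hle'
      (LinearMap.finrank_le_finrank_of_surjective hsurj'))).2 hsurj'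
  have h2 : DirectSum.IsInternal B := ⟨hinj, hsurj'⟩
  exact h2

end Internal

/-! ### Modules induced from characters of `u⁰` -/

section Rep

variable {K : Type*} [Field K]

/-- The space underlying the module `u ⊗_{u⁰} χ` induced from a character `χ` of `u⁰`. -/
abbrev IndSpace (K : Type*) [Field K] (N : ℕ) : Type _ := Fin N × Fin N → K

/-- The vector `F ^ a E ^ b ⊗ 1` of the induced module, zero as soon as `a` or `b` is at
least `N`. -/
def indVec (K : Type*) [Field K] (N a b : ℕ) : IndSpace K N :=
  if h : a < N ∧ b < N then Pi.single (⟨a, h.1⟩, ⟨b, h.2⟩) 1 else 0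

/-- The endomorphism of the induced module with prescribed values on the vectors `indVec`. -/
noncomputable def indOp {N : ℕ} (f : ℕ → ℕ → IndSpace K N) : Module.End K (IndSpace K N) :=
  (Pi.basisFun K (Fin N × Fin N)).constr K fun p => f p.1 p.2

theorem indVec_of_not {N a b : ℕ} (h : ¬(a < N ∧ b < N)) : indVec K N a b = 0 := dif_neg h

theorem basisFun_eq_indVec {N : ℕ} (p : Fin N × Fin N) :
    Pi.basisFun K (Fin N × Fin N) p = indVec K N p.1 p.2 := by
  simp [indVec]

theorem indOp_indVec {N : ℕ} {f : ℕ → ℕ → IndSpace K N}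
    (hf : ∀ a b, ¬(a < N ∧ b < N) → f a b = 0) (a b : ℕ) :
    indOp f (indVec K N a b) = f a b := by
  by_cases h : a < N ∧ b < N
  · have := (Pi.basisFun K (Fin N × Fin N)).constr_basis K (fun p => f p.1 p.2)
      (⟨a, h.1⟩, ⟨b, h.2⟩)
    rwa [basisFun_eq_indVec] at this
  · rw [indVec_of_not h, map_zero, hf a b h]

theorem ind_ext {N : ℕ} {S T : Module.End K (IndSpace K N)}
    (h : ∀ a b, S (indVec K N a b) = T (indVec K N a b)) : S = T :=
  (Pi.basisFun K (Fin N × Fin N)).ext fun p => by rw [basisFun_eq_indVec, h]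

variable (n : ℕ) (q ζ η : K)

/-- The action of `k` on the module induced from the character `k ↦ ζ`, `kh ↦ η`. -/
noncomputable def indK : Module.End K (IndSpace K (n ^ 2)) :=
  indOp fun a b => (ζ * (q ^ n) ^ b * (q ^ n)⁻¹ ^ a) • indVec K (n ^ 2) a b

/-- The action of `kh` on the module induced from the character `k ↦ ζ`, `kh ↦ η`. -/
noncomputable def indKh : Module.End K (IndSpace K (n ^ 2)) :=
  indOp fun a b => (η * (q ^ n * (q ^ 2)⁻¹) ^ b * ((q ^ n)⁻¹ * q ^ 2) ^ a) • indVec K (n ^ 2) a b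

/-- The action of `F` on an induced module. -/
noncomputable def indF : Module.End K (IndSpace K (n ^ 2)) :=
  indOp fun a b => indVec K (n ^ 2) (a + 1) b

/-- The action of `E` on the module induced from the character `k ↦ ζ`, `kh ↦ η`. -/
noncomputable def indE : Module.End K (IndSpace K (n ^ 2)) :=
  indOp fun a b => q ^ a • indVec K (n ^ 2) a (b + 1) -
    (qInt q a * (q - q ^ a * (ζ⁻¹ * η * (q ^ 2)⁻¹ ^ b))) • indVec K (n ^ 2) (a - 1) b

variable {n q ζ η}

theorem indK_indVec (a b : ℕ) : indK n q ζ (indVec K (n ^ 2) a b) =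
    (ζ * (q ^ n) ^ b * (q ^ n)⁻¹ ^ a) • indVec K (n ^ 2) a b :=
  indOp_indVec (fun a b h => by rw [indVec_of_not h, smul_zero]) a b

theorem indKh_indVec (a b : ℕ) : indKh n q η (indVec K (n ^ 2) a b) =
    (η * (q ^ n * (q ^ 2)⁻¹) ^ b * ((q ^ n)⁻¹ * q ^ 2) ^ a) • indVec K (n ^ 2) a b :=
  indOp_indVec (fun a b h => by rw [indVec_of_not h, smul_zero]) a b

theorem indF_indVec (a b : ℕ) :
    indF n (indVec K (n ^ 2) a b) = indVec K (n ^ 2) (a + 1) b :=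
  indOp_indVec (f := fun a b => indVec K (n ^ 2) (a + 1) b)
    (fun a b h => indVec_of_not (by omega)) a b

theorem indE_indVec (hq : IsPrimitiveRoot q (n ^ 2)) (hn : 1 < n) (a b : ℕ) :
    indE n q ζ η (indVec K (n ^ 2) a b) = q ^ a • indVec K (n ^ 2) a (b + 1) -
    (qInt q a * (q - q ^ a * (ζ⁻¹ * η * (q ^ 2)⁻¹ ^ b))) • indVec K (n ^ 2) (a - 1) b := by
  refine indOp_indVec (fun a b h => ?_) a b
  rw [indVec_of_not (K := K) (a := a) (b := b + 1) (by omega), smul_zero, zero_sub, neg_eq_zero]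
  -- The vector `F ^ (n ^ 2 - 1) E ^ b ⊗ 1` occurs in this formula with coefficient `0`.
  rcases eq_or_ne a (n ^ 2) with rfl | ha
  · rw [qInt_eq_zero hq (Nat.one_lt_pow two_ne_zero hn), zero_mul, zero_smul]
  · rw [indVec_of_not (by omega), smul_zero]

theorem indF_pow_indVec (m a b : ℕ) :
    (indF n ^ m) (indVec K (n ^ 2) a b) = indVec K (n ^ 2) (a + m) b := by
  induction m with
  | zero => simp
  | succ m ih => rw [pow_succ' (indF n), Module.End.mul_apply, ih, indF_indVec, add_assoc]

theorem indE_pow_indVec (hq : IsPrimitiveRoot q (n ^ 2)) (hn : 1 < n) (m b : ℕ) :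
    (indE n q ζ η ^ m) (indVec K (n ^ 2) 0 b) = indVec K (n ^ 2) 0 (b + m) := by
  induction m with
  | zero => simp
  | succ m ih =>
    rw [pow_succ' (indE n q ζ η), Module.End.mul_apply, ih, indE_indVec hq hn]
    simp [add_assoc]

theorem indK_pow_indVec (m a b : ℕ) : (indK n q ζ ^ m) (indVec K (n ^ 2) a b) =
    (ζ * (q ^ n) ^ b * (q ^ n)⁻¹ ^ a) ^ m • indVec K (n ^ 2) a b := by
  induction m with
  | zero => simp
  | succ m ih =>
    rw [pow_succ' (indK n q ζ), Module.End.mul_apply, ih, map_smul, indK_indVec, smul_smul,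
      ← pow_succ]

theorem indKh_pow_indVec (m a b : ℕ) : (indKh n q η ^ m) (indVec K (n ^ 2) a b) =
    (η * (q ^ n * (q ^ 2)⁻¹) ^ b * ((q ^ n)⁻¹ * q ^ 2) ^ a) ^ m • indVec K (n ^ 2) a b := by
  induction m with
  | zero => simp
  | succ m ih =>
    rw [pow_succ' (indKh n q η), Module.End.mul_apply, ih, map_smul, indKh_indVec, smul_smul,
      ← pow_succ]

theorem pow_pow_eq_one_of_primitive (hq : IsPrimitiveRoot q (n ^ 2)) : (q ^ n) ^ n = 1 := by
  rw [← pow_mul, ← sq, hq.pow_eq_one]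

theorem weight_pow_eq_one (hq : IsPrimitiveRoot q (n ^ 2)) (hζ : ζ ^ n = 1) (a b : ℕ) :
    (ζ * (q ^ n) ^ b * (q ^ n)⁻¹ ^ a) ^ n = 1 := by
  rw [mul_pow, mul_pow, hζ, pow_right_comm _ b, pow_right_comm _ a, inv_pow,
    pow_pow_eq_one_of_primitive hq]
  simp

/-- The action of `κ = k⁻¹ kh` on the module induced from the character `k ↦ ζ`, `kh ↦ η`. -/
theorem indK_pow_mul_indKh_indVec (hq : IsPrimitiveRoot q (n ^ 2)) (hn : 1 < n) (hζ : ζ ^ n = 1)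
    (a b : ℕ) : (indK n q ζ ^ (n - 1) * indKh n q η) (indVec K (n ^ 2) a b) =
      (ζ⁻¹ * η * (q ^ 2)⁻¹ ^ b * (q ^ 2) ^ a) • indVec K (n ^ 2) a b := by
  have hq0 : q ≠ 0 := hq.ne_zero (by positivity)
  have hζ0 : ζ ≠ 0 := by rintro rfl; simp [show n ≠ 0 by omega] at hζ
  have h2 : (ζ * (q ^ n) ^ b * (q ^ n)⁻¹ ^ a) ^ (n - 1) = (ζ * (q ^ n) ^ b * (q ^ n)⁻¹ ^ a)⁻¹ :=
    eq_inv_of_mul_eq_one_left (by rw [← pow_succ, Nat.sub_add_cancel (by omega),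
      weight_pow_eq_one hq hζ])
  rw [Module.End.mul_apply, indKh_indVec, map_smul, indK_pow_indVec, h2, smul_smul]
  congr 1
  simp only [mul_pow, inv_pow, mul_inv, inv_inv]
  field_simp

theorem indF_mul_indE (hq : IsPrimitiveRoot q (n ^ 2)) (hn : 1 < n) (hζ : ζ ^ n = 1) :
    indF n * indE n q ζ η = q⁻¹ • (indE n q ζ η * indF n) +
      (1 - indK n q ζ ^ (n - 1) * indKh n q η) := by
  have hq0 : q ≠ 0 := hq.ne_zero (by positivity)
  refine ind_ext fun a b => ?_
  rw [LinearMap.add_apply, LinearMap.sub_apply, LinearMap.smul_apply,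
    indK_pow_mul_indKh_indVec hq hn hζ, Module.End.mul_apply, Module.End.mul_apply, indF_indVec,
    indE_indVec hq hn, indE_indVec hq hn, map_sub, map_smul, map_smul, indF_indVec, indF_indVec,
    Module.End.one_apply]
  generalize ζ⁻¹ * η * (q ^ 2)⁻¹ ^ b = μ
  rcases a with _ | a
  · simp only [qInt]
    simp
    match_scalars
    all_goals field_simp
    ring
  · rw [Nat.add_sub_cancel, Nat.add_sub_cancel, qInt_succ (a + 1)]
    have h := qInt_succ (p := q) a
    rw [qInt_succ'] at h
    match_scalars
    · simp only [pow_succ]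
      field_simp
    · rw [qInt_succ' a]
      field_simp
      linear_combination (-q ^ 2) * h

theorem indK_mul_indE (hq : IsPrimitiveRoot q (n ^ 2)) (hn : 1 < n) :
    indK n q ζ * indE n q ζ η = q ^ n • (indE n q ζ η * indK n q ζ) := by
  have hq0 : q ≠ 0 := hq.ne_zero (by positivity)
  refine ind_ext fun a b => ?_
  rw [LinearMap.smul_apply, Module.End.mul_apply, Module.End.mul_apply, indK_indVec, map_smul,
    indE_indVec hq hn, map_sub, map_smul, map_smul, indK_indVec, indK_indVec]
  rcases a with _ | a
  · simp; match_scalars; ring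
  · rw [Nat.add_sub_cancel]; match_scalars <;> simp only [pow_succ] <;> field_simp

theorem indKh_mul_indE (hq : IsPrimitiveRoot q (n ^ 2)) (hn : 1 < n) :
    indKh n q η * indE n q ζ η = (q ^ n * (q ^ 2)⁻¹) • (indE n q ζ η * indKh n q η) := by
  have hq0 : q ≠ 0 := hq.ne_zero (by positivity)
  refine ind_ext fun a b => ?_
  rw [LinearMap.smul_apply, Module.End.mul_apply, Module.End.mul_apply, indKh_indVec, map_smul,
    indE_indVec hq hn, map_sub, map_smul, map_smul, indKh_indVec, indKh_indVec]
  rcases a with _ | a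
  · simp; match_scalars; ring
  · rw [Nat.add_sub_cancel]; match_scalars <;> simp only [pow_succ] <;> field_simp

theorem indE_pow_eq_zero (hq : IsPrimitiveRoot q (n ^ 2)) (hn : 1 < n) (hζ : ζ ^ n = 1) :
    indE n q ζ η ^ (n ^ 2) = 0 := by
  have hq0 : q ≠ 0 := hq.ne_zero (by positivity)
  have hN : 1 < n ^ 2 := Nat.one_lt_pow two_ne_zero hn
  -- `E ^ (n ^ 2)` commutes with `F`, so it suffices to look at the vectors `E ^ b ⊗ 1`.
  have hκ : (indK n q ζ ^ (n - 1) * indKh n q η) * indE n q ζ η =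
      (q ^ 2)⁻¹ • (indE n q ζ η * (indK n q ζ ^ (n - 1) * indKh n q η)) := by
    refine ind_ext fun a b => ?_
    rw [LinearMap.smul_apply, Module.End.mul_apply, Module.End.mul_apply (indE n q ζ η),
      indK_pow_mul_indKh_indVec hq hn hζ, map_smul, indE_indVec hq hn, map_sub, map_smul, map_smul,
      indK_pow_mul_indKh_indVec hq hn hζ, indK_pow_mul_indKh_indVec hq hn hζ]
    rcases a with _ | a
    · simp; match_scalars; ring
    · rw [Nat.add_sub_cancel]; match_scalars <;> simp only [pow_succ] <;> field_simp
  have hc : Commute (indF n) (indE n q ζ η ^ (n ^ 2)) := by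
    have h := mul_pow_succ_of_rel (indF_mul_indE (η := η) hq hn hζ) hκ (n ^ 2 - 1)
    rw [Nat.sub_add_cancel hN.le, qInt_eq_zero hq.inv hN, inv_pow, hq.pow_eq_one, inv_one,
      one_smul, zero_smul, add_zero] at h
    exact h
  refine ind_ext fun a b => ?_
  have h := congrArg (· (indVec K (n ^ 2) 0 b)) (hc.pow_left a).eq
  simp only [Module.End.mul_apply, indE_pow_indVec hq hn, indF_pow_indVec, zero_add] at h
  rw [← h, indVec_of_not (by omega)]
  rfl

/-- The action of `u` on the module induced from the character `k ↦ ζ`, `kh ↦ η` of `u⁰`. -/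
noncomputable def indRep (hq : IsPrimitiveRoot q (n ^ 2)) (hn : 1 < n) (hζ : ζ ^ n = 1)
    (hη : η ^ n = ζ⁻¹ ^ 2) : U n q →ₐ[K] Module.End K (IndSpace K (n ^ 2)) :=
  RingQuot.liftAlgHom K ⟨FreeAlgebra.lift K fun g => match g with
    | Gen.k => indK n q ζ
    | Gen.kh => indKh n q η
    | Gen.E => indE n q ζ η
    | Gen.F => indF n, by
    have hq0 : q ≠ 0 := hq.ne_zero (by positivity)
    have hnq := pow_pow_eq_one_of_primitive hq
    have hζ0 : ζ ≠ 0 := by rintro rfl; simp [show n ≠ 0 by omega] at hζ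
    have hinv : ∀ {z : K}, z ^ n = 1 → z ^ (n - 1) = z⁻¹ := fun hz =>
      eq_inv_of_mul_eq_one_left (by rw [← pow_succ, Nat.sub_add_cancel (by omega), hz])
    intro x y h
    cases h with
    | k_pow =>
      simp only [map_pow, FreeAlgebra.lift_ι_apply, map_one]
      refine ind_ext fun a b => ?_
      rw [indK_pow_indVec, weight_pow_eq_one hq hζ, one_smul, Module.End.one_apply]
    | kh_pow =>
      simp only [map_pow, FreeAlgebra.lift_ι_apply]
      refine ind_ext fun a b => ?_
      rw [← pow_mul, indK_pow_indVec, indKh_pow_indVec, pow_mul, hinv (weight_pow_eq_one hq hζ a b)]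
      congr 1
      have h1 : (q ^ n * (q ^ 2)⁻¹) ^ n = (q ^ n)⁻¹ ^ 2 := by
        rw [mul_pow, hnq, one_mul, inv_pow, inv_pow, ← pow_mul, ← pow_mul, mul_comm]
      have h2 : ((q ^ n)⁻¹ * q ^ 2) ^ n = (q ^ n) ^ 2 := by
        rw [mul_pow, inv_pow, hnq, inv_one, one_mul, ← pow_mul, ← pow_mul, mul_comm]
      rw [mul_pow, mul_pow, hη, pow_right_comm _ b, pow_right_comm _ a, h1, h2]
      generalize q ^ n = w
      simp only [mul_inv, inv_pow, inv_inv]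
      ring
    | k_kh =>
      simp only [map_mul, FreeAlgebra.lift_ι_apply]
      refine ind_ext fun a b => ?_
      simp only [Module.End.mul_apply, indK_indVec, indKh_indVec, map_smul]
      rw [smul_comm]
    | k_E => simpa only [map_mul, map_smul, FreeAlgebra.lift_ι_apply] using indK_mul_indE hq hn
    | k_F =>
      simp only [map_mul, map_smul, FreeAlgebra.lift_ι_apply]
      refine ind_ext fun a b => ?_
      simp only [Module.End.mul_apply, indK_indVec, indF_indVec, map_smul, LinearMap.smul_apply]
      match_scalars
      ring
    | kh_E => simpa only [map_mul, map_smul, FreeAlgebra.lift_ι_apply] using indKh_mul_indE hq hn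
    | kh_F =>
      simp only [map_mul, map_smul, FreeAlgebra.lift_ι_apply]
      refine ind_ext fun a b => ?_
      simp only [Module.End.mul_apply, indKh_indVec, indF_indVec, map_smul, LinearMap.smul_apply]
      match_scalars
      ring
    | E_pow =>
      simpa only [map_pow, map_zero, FreeAlgebra.lift_ι_apply] using indE_pow_eq_zero hq hn hζ
    | F_pow =>
      simp only [map_pow, map_zero, FreeAlgebra.lift_ι_apply]
      refine ind_ext fun a b => ?_
      rw [indF_pow_indVec, indVec_of_not (by omega)]
      rfl
    | F_E =>
      simp only [map_mul, map_sub, map_smul, map_one, map_pow, FreeAlgebra.lift_ι_apply]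
      rw [indF_mul_indE hq hn hζ, add_sub_cancel_left]⟩

variable (hq : IsPrimitiveRoot q (n ^ 2)) (hn : 1 < n) (hζ : ζ ^ n = 1) (hη : η ^ n = ζ⁻¹ ^ 2)

theorem indRep_k : indRep hq hn hζ hη (k n q) = indK n q ζ := by
  rw [k, indRep, RingQuot.liftAlgHom_mkAlgHom_apply, FreeAlgebra.lift_ι_apply]

theorem indRep_kh : indRep hq hn hζ hη (kh n q) = indKh n q η := by
  rw [kh, indRep, RingQuot.liftAlgHom_mkAlgHom_apply, FreeAlgebra.lift_ι_apply]

theorem indRep_E : indRep hq hn hζ hη (E n q) = indE n q ζ η := by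
  rw [E, indRep, RingQuot.liftAlgHom_mkAlgHom_apply, FreeAlgebra.lift_ι_apply]

theorem indRep_F : indRep hq hn hζ hη (F n q) = indF n := by
  rw [F, indRep, RingQuot.liftAlgHom_mkAlgHom_apply, FreeAlgebra.lift_ι_apply]

end Rep

/-! ### The Cartan part -/

/-- The standing assumptions on the parameters `n` and `q`. -/
structure IsParam {K : Type*} [Field K] (n : ℕ) (q : K) : Prop where
  pos : 0 < n
  four_dvd : 4 ∣ n
  prim : IsPrimitiveRoot q (n ^ 2)

section Param

variable {K : Type*} [Field K] {n : ℕ} {q : K} (h : IsParam n q)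
include h

namespace IsParam

theorem four_le : 4 ≤ n := Nat.le_of_dvd h.pos h.four_dvd

theorem one_lt : 1 < n := by have := h.four_le; omega

theorem one_lt_sq : 1 < n ^ 2 := Nat.one_lt_pow two_ne_zero h.one_lt

theorem half : 2 * (n / 2) = n := by have := h.four_dvd; omega

theorem even_half : Even (n / 2) := by
  obtain ⟨l, rfl⟩ := h.four_dvd
  exact ⟨l, by omega⟩

/-- `n ^ 2` is twice the order `n / 2 * n` of `κ`. -/
theorem two_mul_half : 2 * (n / 2 * n) = n ^ 2 := by
  rw [← mul_assoc, h.half, sq]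

theorem half_pos : 0 < n / 2 * n := by
  have := h.two_mul_half
  have := h.one_lt_sq
  omega

theorem ne_zero : q ≠ 0 := h.prim.ne_zero (by have := h.one_lt_sq; omega)

theorem pow_half : q ^ (n / 2 * n) = -1 := by
  have h1 : (q ^ (n / 2 * n)) ^ 2 = 1 := by
    rw [← pow_mul, mul_comm, h.two_mul_half, h.prim.pow_eq_one]
  rcases eq_or_eq_neg_of_sq_eq_sq _ 1 (h1.trans (one_pow 2).symm) with h2 | h2
  · exact absurd h2 (h.prim.pow_ne_one_of_pos_of_lt h.half_pos.ne'
      (by have := h.two_mul_half; have := h.half_pos; omega))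
  · exact h2

theorem sq_pow_inj {i j : ℕ} (hi : i < n / 2 * n) (hj : j < n / 2 * n)
    (hij : q ^ (2 * i) = q ^ (2 * j)) : i = j := by
  have := h.two_mul_half
  have := h.prim.pow_inj (by omega) (by omega) hij
  omega

/-- The scalar by which `k kh ^ (n / 2)` and `E` commute. -/
theorem sgn_scalar : q ^ n * (q ^ n * (q ^ 2)⁻¹) ^ (n / 2) = -1 := by
  have hq := h.ne_zero
  rw [mul_pow, inv_pow, ← pow_mul, ← pow_mul, h.half, mul_comm n, h.pow_half]
  field_simp

end IsParam
end Param

section Relations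

variable {K : Type*} [Field K] (n : ℕ) (q : K)

/-- The element `κ = k⁻¹ kh`, which is diagonalised by the idempotents `e`. -/
def kap : U n q := kInv n q * kh n q

/-- The involution `k kh ^ (n / 2)`. -/
def sgn : U n q := k n q * kh n q ^ (n / 2)

theorem kh_pow : kh n q ^ n = kInv n q ^ 2 := by
  simpa [k, kh, kInv] using RingQuot.mkAlgHom_rel K (Rel.kh_pow (n := n) (q := q))

theorem k_kh : Commute (k n q) (kh n q) := by
  simpa [Commute, SemiconjBy, k, kh] using RingQuot.mkAlgHom_rel K (Rel.k_kh (n := n) (q := q))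

theorem k_mul_E : k n q * E n q = q ^ n • (E n q * k n q) := by
  simpa [k, E] using RingQuot.mkAlgHom_rel K (Rel.k_E (n := n) (q := q))

theorem k_mul_F : k n q * F n q = (q ^ n)⁻¹ • (F n q * k n q) := by
  simpa [k, F] using RingQuot.mkAlgHom_rel K (Rel.k_F (n := n) (q := q))

theorem kh_mul_E : kh n q * E n q = (q ^ n * (q ^ 2)⁻¹) • (E n q * kh n q) := by
  simpa [kh, E] using RingQuot.mkAlgHom_rel K (Rel.kh_E (n := n) (q := q))

theorem kh_mul_F : kh n q * F n q = ((q ^ n)⁻¹ * q ^ 2) • (F n q * kh n q) := by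
  simpa [kh, F] using RingQuot.mkAlgHom_rel K (Rel.kh_F (n := n) (q := q))

theorem E_pow : E n q ^ (n ^ 2) = 0 := by
  simpa [E] using RingQuot.mkAlgHom_rel K (Rel.E_pow (n := n) (q := q))

theorem F_pow : F n q ^ (n ^ 2) = 0 := by
  simpa [F] using RingQuot.mkAlgHom_rel K (Rel.F_pow (n := n) (q := q))

theorem E_pow_of_le {a : ℕ} (ha : n ^ 2 ≤ a) : E n q ^ a = 0 :=
  pow_eq_zero_of_le ha (E_pow n q)

theorem F_pow_of_le {a : ℕ} (ha : n ^ 2 ≤ a) : F n q ^ a = 0 :=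
  pow_eq_zero_of_le ha (F_pow n q)

theorem F_mul_E : F n q * E n q = q⁻¹ • (E n q * F n q) + (1 - kap n q) := by
  have h := RingQuot.mkAlgHom_rel K (Rel.F_E (n := n) (q := q))
  rw [map_sub, map_mul, map_smul, map_mul, map_sub, map_one, map_mul, map_pow,
    sub_eq_iff_eq_add'] at h
  exact h

theorem k_kInv : Commute (k n q) (kInv n q) := (Commute.refl _).pow_right _

theorem kInv_kh : Commute (kInv n q) (kh n q) := (k_kh n q).pow_left _

theorem sgn_kap : Commute (sgn n q) (kap n q) :=
  ((k_kInv n q).mul_right (k_kh n q)).mul_left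
    (((kInv_kh n q).symm.mul_right (Commute.refl _)).pow_left _)

theorem kInv_pow : kInv n q ^ n = 1 := by
  rw [kInv, ← pow_mul, mul_comm, pow_mul, k_pow, one_pow]

theorem F_mul_E_pow_succ (hκ : kap n q * E n q = (q ^ 2)⁻¹ • (E n q * kap n q)) (a : ℕ) :
    F n q * E n q ^ (a + 1) = q⁻¹ ^ (a + 1) • (E n q ^ (a + 1) * F n q) +
      qInt q⁻¹ (a + 1) • (E n q ^ a * (1 - q⁻¹ ^ a • kap n q)) :=
  mul_pow_succ_of_rel (F_mul_E n q) hκ a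

theorem phi_eq (i : ℕ) : phi n q i = ((n / 2 * n : ℕ) : K)⁻¹ •
    ∑ t ∈ Finset.range (n / 2 * n), (q⁻¹ ^ (2 * i * t)) • kap n q ^ t := rfl

theorem sgnIdem_eq (j : Fin 2) :
    sgnIdem n q j = (2 : K)⁻¹ • (1 + ((-1 : K) ^ (j : ℕ)) • sgn n q) := rfl

theorem kap_phi (i : ℕ) : Commute (kap n q) (phi n q i) :=
  Commute.smul_right (Commute.sum_right _ _ _ fun _ _ =>
    ((Commute.refl _).pow_right _).smul_right _) _

theorem sgn_phi (i : ℕ) : Commute (sgn n q) (phi n q i) :=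
  Commute.smul_right (Commute.sum_right _ _ _ fun _ _ =>
    ((sgn_kap n q).pow_right _).smul_right _) _

theorem kap_sgnIdem (j : Fin 2) : Commute (kap n q) (sgnIdem n q j) :=
  Commute.smul_right ((Commute.one_right _).add_right ((sgn_kap n q).symm.smul_right _)) _

theorem sgn_sgnIdem (j : Fin 2) : Commute (sgn n q) (sgnIdem n q j) :=
  Commute.smul_right ((Commute.one_right _).add_right ((Commute.refl _).smul_right _)) _

theorem kap_e (i : ℕ) (j : Fin 2) : Commute (kap n q) (e n q i j) :=
  (kap_phi n q i).mul_right (kap_sgnIdem n q j)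

theorem sgn_e (i : ℕ) (j : Fin 2) : Commute (sgn n q) (e n q i j) :=
  (sgn_phi n q i).mul_right (sgn_sgnIdem n q j)

theorem sum_sgnIdem [CharZero K] : ∑ j, sgnIdem n q j = 1 := by
  rw [Fin.sum_univ_two, sgnIdem_eq n q, sgnIdem_eq n q, ← smul_add]
  simp only [Fin.val_zero, Fin.val_one, pow_zero, pow_one]
  module

end Relations

section ScalarCommutation

variable {K A : Type*} [Field K] [Ring A] [Algebra K A] {x y : A} {c : K}

theorem pow_mul_of_mul (h : x * y = c • (y * x)) (m : ℕ) : x ^ m * y = c ^ m • (y * x ^ m) := by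
  induction m with
  | zero => simp
  | succ m ih =>
    rw [pow_succ, mul_assoc, h, mul_smul_comm, ← mul_assoc, ih, smul_mul_assoc, smul_smul,
      mul_assoc, ← pow_succ, ← pow_succ']

theorem mul_pow_of_mul (h : x * y = c • (y * x)) (m : ℕ) : x * y ^ m = c ^ m • (y ^ m * x) := by
  induction m with
  | zero => simp
  | succ m ih =>
    rw [pow_succ, ← mul_assoc, ih, smul_mul_assoc, mul_assoc, h, mul_smul_comm, smul_smul,
      mul_assoc, ← pow_succ]

end ScalarCommutation

section Param

variable {K : Type*} [Field K] {n : ℕ} {q : K} (h : IsParam n q)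
include h

theorem kInv_mul_E : kInv n q * E n q = (q ^ n)⁻¹ • (E n q * kInv n q) := by
  have h1 : (q ^ n) ^ (n - 1) = (q ^ n)⁻¹ :=
    eq_inv_of_mul_eq_one_left (by
      rw [← pow_succ, Nat.sub_add_cancel h.pos, pow_pow_eq_one_of_primitive h.prim])
  rw [kInv, pow_mul_of_mul (k_mul_E n q), h1]

theorem kInv_mul_F : kInv n q * F n q = q ^ n • (F n q * kInv n q) := by
  have h1 : (q ^ n)⁻¹ ^ (n - 1) = q ^ n := by
    rw [inv_pow]
    exact inv_eq_of_mul_eq_one_right (by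
      rw [← pow_succ, Nat.sub_add_cancel h.pos, pow_pow_eq_one_of_primitive h.prim])
  rw [kInv, pow_mul_of_mul (k_mul_F n q), h1]

theorem kap_mul_E : kap n q * E n q = (q ^ 2)⁻¹ • (E n q * kap n q) := by
  have hq := h.ne_zero
  rw [kap, mul_assoc, kh_mul_E, mul_smul_comm, ← mul_assoc, kInv_mul_E h, smul_mul_assoc,
    smul_smul, mul_assoc, mul_assoc]
  congr 1
  field_simp

theorem kap_mul_F : kap n q * F n q = q ^ 2 • (F n q * kap n q) := by
  have hq := h.ne_zero
  rw [kap, mul_assoc, kh_mul_F, mul_smul_comm, ← mul_assoc, kInv_mul_F h, smul_mul_assoc,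
    smul_smul, mul_assoc, mul_assoc]
  congr 1
  field_simp

theorem E_mul_kap_pow (t : ℕ) : E n q * kap n q ^ t = q ^ (2 * t) • (kap n q ^ t * E n q) := by
  have hq := h.ne_zero
  rw [pow_mul_of_mul (kap_mul_E h), smul_smul, inv_pow, ← pow_mul, mul_inv_cancel₀ (by positivity),
    one_smul]

theorem sgn_mul_E : sgn n q * E n q = -(E n q * sgn n q) := by
  rw [sgn, mul_assoc, pow_mul_of_mul (kh_mul_E n q), mul_smul_comm, ← mul_assoc, k_mul_E,
    smul_mul_assoc, smul_smul, mul_assoc, mul_comm, h.sgn_scalar, neg_one_smul]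

theorem kap_pow_half : kap n q ^ (n / 2 * n) = 1 := by
  rw [mul_comm, pow_mul, kap, (kInv_kh n q).mul_pow, kInv_pow, one_mul, kh_pow, ← pow_mul, h.half,
    kInv_pow]

theorem sgn_sq : sgn n q * sgn n q = 1 := by
  rw [← sq, sgn, ((k_kh n q).pow_right _).mul_pow, ← pow_mul, mul_comm (n / 2), h.half, kh_pow,
    ← (k_kInv n q).mul_pow, k_mul_kInv n q h.pos, one_pow]

/-- The group algebra `u⁰` is generated by `κ` and `sgn`. -/
theorem k_eq : k n q = sgn n q * kap n q ^ ((n / 2) ^ 2 - n / 2) := by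
  obtain ⟨l, hl⟩ := h.even_half
  have h2 : (n / 2) ^ 2 = n * l := by
    have := h.half
    calc (n / 2) ^ 2 = 2 * (n / 2) * l := by rw [sq]; nth_rewrite 2 [hl]; ring
      _ = n * l := by rw [this]
  have h3 : n / 2 ≤ (n / 2) ^ 2 := Nat.le_self_pow two_ne_zero _
  have hP : (n / 2) ^ 2 - n / 2 + n / 2 = (n / 2) ^ 2 := Nat.sub_add_cancel h3
  rw [sgn, kap, (kInv_kh n q).mul_pow, mul_assoc, ← mul_assoc (kh n q ^ _),
    ((kInv_kh n q).pow_pow _ _).symm.eq, mul_assoc, ← pow_add, add_comm (n / 2), hP, h2,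
      pow_mul (kh n q),
    kh_pow, ← pow_mul, ← pow_add, show 2 * l = n / 2 by omega, ← h2, hP, h2, pow_mul, kInv_pow,
      one_pow, mul_one]

theorem kh_eq : kh n q = k n q * kap n q := by
  rw [kap, ← mul_assoc, k_mul_kInv n q h.pos, one_mul]

/-! ### The idempotents -/

theorem kap_mul_phi (i : ℕ) : kap n q * phi n q i = q ^ (2 * i) • phi n q i := by
  have hq := h.ne_zero
  rw [phi_eq, mul_smul_comm, smul_comm (q ^ (2 * i))]
  congr 1
  set f : ℕ → U n q := fun t => q⁻¹ ^ (2 * i * t) • kap n q ^ t with hf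
  have h0 : f (n / 2 * n) = f 0 := by
    simp only [hf, kap_pow_half h]
    rw [mul_comm 2 i, mul_assoc, h.two_mul_half, mul_comm, pow_mul, inv_pow, h.prim.pow_eq_one]
    simp
  have h1 : ∑ t ∈ Finset.range (n / 2 * n), f (t + 1) = ∑ t ∈ Finset.range (n / 2 * n), f t := by
    have h2 := Finset.sum_range_succ f (n / 2 * n)
    rw [Finset.sum_range_succ', h0] at h2
    exact add_right_cancel h2
  conv_rhs => rw [← h1]
  rw [Finset.mul_sum, Finset.smul_sum]
  refine Finset.sum_congr rfl fun t _ => ?_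
  simp only [hf]
  rw [mul_smul_comm, ← pow_succ' (kap n q), smul_smul]
  congr 1
  rw [mul_add, pow_add, mul_one, mul_comm (q⁻¹ ^ _), ← mul_assoc, ← mul_pow, mul_inv_cancel₀ hq,
    one_pow, one_mul]

theorem E_mul_phi (i : ℕ) : E n q * phi n q (i + 1) = phi n q i * E n q := by
  have hq := h.ne_zero
  rw [phi_eq n q, phi_eq n q, mul_smul_comm, smul_mul_assoc, Finset.mul_sum, Finset.sum_mul]
  congr 1
  refine Finset.sum_congr rfl fun t _ => ?_
  rw [mul_smul_comm, E_mul_kap_pow h, smul_smul, smul_mul_assoc]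
  congr 1
  rw [show 2 * (i + 1) * t = 2 * i * t + 2 * t by ring, pow_add, mul_assoc, ← mul_pow,
    inv_mul_cancel₀ hq, one_pow, mul_one]

theorem phi_add_half (i : ℕ) : phi n q (i + n / 2 * n) = phi n q i := by
  rw [phi_eq n q, phi_eq n q]
  congr 1
  refine Finset.sum_congr rfl fun t _ => ?_
  congr 1
  rw [mul_add, h.two_mul_half, add_mul, pow_add, pow_mul _ (n ^ 2), h.prim.inv.pow_eq_one, one_pow,
    mul_one]

theorem sum_phi [CharZero K] : ∑ i ∈ Finset.range (n / 2 * n), phi n q i = 1 := by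
  have hq := h.ne_zero
  have hM : ((n / 2 * n : ℕ) : K) ≠ 0 := Nat.cast_ne_zero.2 h.half_pos.ne'
  simp only [phi_eq n q, ← Finset.smul_sum]
  rw [inv_smul_eq_iff₀ hM, Finset.sum_comm, Finset.sum_eq_single 0]
  · simp only [mul_zero, pow_zero, one_smul, Finset.sum_const, Finset.card_range,
      Nat.cast_smul_eq_nsmul]
  · intro t ht ht0
    rw [← Finset.sum_smul]
    have ht := Finset.mem_range.1 ht
    have hz : q⁻¹ ^ (2 * t) ≠ 1 := h.prim.inv.pow_ne_one_of_pos_of_lt (by omega)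
      (by have := h.two_mul_half; omega)
    have hs : ∑ i ∈ Finset.range (n / 2 * n), q⁻¹ ^ (2 * i * t) = 0 := by
      have h1 := qInt_mul (p := q⁻¹ ^ (2 * t)) (n / 2 * n)
      have h2 : 2 * t * (n / 2 * n) = n ^ 2 * t := by rw [← h.two_mul_half]; ring
      rw [← pow_mul q⁻¹ (2 * t), h2, pow_mul q⁻¹ (n ^ 2), h.prim.inv.pow_eq_one, one_pow,
        sub_self] at h1
      rw [← (mul_eq_zero.1 h1).resolve_right (sub_ne_zero.2 hz), qInt]
      refine Finset.sum_congr rfl fun i _ => ?_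
      rw [← pow_mul]
      congr 1
      ring
    rw [hs, zero_smul]
  · intro h0
    exact absurd (Finset.mem_range.2 h.half_pos) h0

theorem sgn_mul_sgnIdem (j : Fin 2) :
    sgn n q * sgnIdem n q j = (-1 : K) ^ (j : ℕ) • sgnIdem n q j := by
  rw [sgnIdem_eq, mul_smul_comm, mul_add, mul_smul_comm, sgn_sq h]
  obtain rfl | rfl : j = 0 ∨ j = 1 := by omega
  · simp [add_comm]
  · simp only [Fin.val_one, pow_one, mul_one]
    module

theorem E_mul_sgnIdem (j : Fin 2) : E n q * sgnIdem n q j = sgnIdem n q (j + 1) * E n q := by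
  rw [sgnIdem_eq n q, sgnIdem_eq n q, mul_smul_comm, smul_mul_assoc, mul_add, add_mul,
    mul_smul_comm,
    smul_mul_assoc, sgn_mul_E h]
  obtain rfl | rfl : j = 0 ∨ j = 1 := by omega
  · simp
  · simp only [Fin.val_one, pow_one, Fin.reduceAdd, Fin.val_zero, pow_zero, one_smul, mul_one,
      one_mul]
    module

theorem kap_mul_e (i : ℕ) (j : Fin 2) : kap n q * e n q i j = q ^ (2 * i) • e n q i j := by
  rw [e, ← mul_assoc, kap_mul_phi h, smul_mul_assoc]

theorem e_mul_kap (i : ℕ) (j : Fin 2) : e n q i j * kap n q = q ^ (2 * i) • e n q i j := by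
  rw [← kap_mul_e h, (kap_e n q i j).eq]

theorem sgn_mul_e (i : ℕ) (j : Fin 2) :
    sgn n q * e n q i j = (-1 : K) ^ (j : ℕ) • e n q i j := by
  rw [e, ← mul_assoc, (sgn_phi n q i).eq, mul_assoc, sgn_mul_sgnIdem h, mul_smul_comm]

theorem e_mul_sgn (i : ℕ) (j : Fin 2) :
    e n q i j * sgn n q = (-1 : K) ^ (j : ℕ) • e n q i j := by
  rw [← sgn_mul_e h, (sgn_e n q i j).eq]

theorem E_mul_e (i : ℕ) (j : Fin 2) : E n q * e n q (i + 1) j = e n q i (j + 1) * E n q := by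
  rw [e, e, ← mul_assoc, E_mul_phi h, mul_assoc, E_mul_sgnIdem h, mul_assoc]

theorem e_add_half (i : ℕ) (j : Fin 2) : e n q (i + n / 2 * n) j = e n q i j := by
  rw [e, e, phi_add_half h]

theorem sum_e [CharZero K] : ∑ i ∈ Finset.range (n / 2 * n), ∑ j, e n q i j = 1 := by
  simp only [e, ← Finset.mul_sum, sum_sgnIdem n q, mul_one, sum_phi h]

theorem exists_k_mul_e (i : ℕ) (j : Fin 2) : ∃ c : K, k n q * e n q i j = c • e n q i j := by
  have hp : ∀ t, kap n q ^ t * e n q i j = (q ^ (2 * i)) ^ t • e n q i j := fun t => by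
    induction t with
    | zero => simp
    | succ t ih => rw [pow_succ, mul_assoc, kap_mul_e h, mul_smul_comm, ih, smul_smul, ← pow_succ']
  exact ⟨_, by rw [k_eq h, mul_assoc, hp, mul_smul_comm, sgn_mul_e h, smul_smul]⟩

theorem exists_kh_mul_e (i : ℕ) (j : Fin 2) : ∃ c : K, kh n q * e n q i j = c • e n q i j := by
  obtain ⟨c, hc⟩ := exists_k_mul_e h i j
  exact ⟨_, by rw [kh_eq h, mul_assoc, kap_mul_e h, mul_smul_comm, hc, smul_smul]⟩

end Param

/-! ### The triangular basis -/

section Scalars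

variable {K : Type*} [Field K] {n : ℕ} {q : K}

/-- A vector on which `k` and `kh` act by scalars is a weight vector for the whole of `u⁰`. -/
theorem exists_smul_of_mem_uZero {V : Type*} [AddCommGroup V] [Module K V]
    (ρ : U n q →ₐ[K] Module.End K V) {v : V} (hk : ∃ c : K, ρ (k n q) v = c • v)
    (hkh : ∃ c : K, ρ (kh n q) v = c • v) {y : U n q} (hy : y ∈ uZero n q) :
    ∃ c : K, ρ y v = c • v := by
  induction hy using Algebra.adjoin_induction with
  | mem x hx =>
    rcases hx with rfl | rfl
    · exact hk
    · exact hkh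
  | algebraMap r => exact ⟨r, by rw [AlgHom.commutes]; rfl⟩
  | add x y _ _ hx hy =>
    obtain ⟨c, hc⟩ := hx
    obtain ⟨d, hd⟩ := hy
    exact ⟨c + d, by rw [map_add, LinearMap.add_apply, hc, hd, add_smul]⟩
  | mul x y _ _ hx hy =>
    obtain ⟨c, hc⟩ := hx
    obtain ⟨d, hd⟩ := hy
    exact ⟨d * c, by rw [map_mul, Module.End.mul_apply, hd, map_smul, hc, smul_smul]⟩

theorem k_mem_uZero : k n q ∈ uZero n q := Algebra.subset_adjoin (by simp)

theorem kh_mem_uZero : kh n q ∈ uZero n q := Algebra.subset_adjoin (by simp)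

theorem e_mem_uZero (i : ℕ) (j : Fin 2) : e n q i j ∈ uZero n q :=
  mul_mem (Subalgebra.smul_mem _ (sum_mem fun _ _ => Subalgebra.smul_mem _
      (pow_mem (mul_mem (pow_mem k_mem_uZero _) kh_mem_uZero) _) _) _)
    (Subalgebra.smul_mem _ (add_mem (one_mem _) (Subalgebra.smul_mem _
      (mul_mem k_mem_uZero (pow_mem kh_mem_uZero _)) _)) _)

theorem E_pow_mem_uPlus (b : ℕ) : E n q ^ b ∈ uPlus n q :=
  Subalgebra.pow_mem _ (Algebra.subset_adjoin (Set.mem_singleton _)) b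

theorem exists_mul_e (h : IsParam n q) {y : U n q} (hy : y ∈ uZero n q) (i : ℕ) (j : Fin 2) :
    ∃ c : K, y * e n q i j = c • e n q i j :=
  exists_smul_of_mem_uZero (Algebra.lmul K (U n q)) (exists_k_mul_e h i j) (exists_kh_mul_e h i j)
    hy

end Scalars

section Layer

variable {K : Type*} [Field K] (n : ℕ) (q : K)

/-- The span of the products `F ^ a * e i j * E ^ b` with `c ≤ a ≤ d`. -/
def layer (c d : ℕ) : Submodule K (U n q) :=
  Submodule.span K {x | ∃ a, c ≤ a ∧ a ≤ d ∧ ∃ i j b, x = F n q ^ a * (e n q i j * E n q ^ b)}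

variable {n q}

theorem mem_layer {c d a : ℕ} (hc : c ≤ a) (hd : a ≤ d) (i : ℕ) (j : Fin 2) (b : ℕ) :
    F n q ^ a * (e n q i j * E n q ^ b) ∈ layer n q c d :=
  Submodule.subset_span ⟨a, hc, hd, i, j, b, rfl⟩

theorem e_mul_E_pow_mem_layer (i : ℕ) (j : Fin 2) (b : ℕ) :
    e n q i j * E n q ^ b ∈ layer n q 0 0 := by
  have h := mem_layer (n := n) (q := q) (le_refl 0) (le_refl 0) i j b
  rwa [pow_zero, one_mul] at h

theorem layer_mono {c d c' d' : ℕ} (hc : c' ≤ c) (hd : d ≤ d') : layer n q c d ≤ layer n q c' d' :=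
  Submodule.span_mono fun _ ⟨a, h1, h2, h3⟩ => ⟨a, hc.trans h1, h2.trans hd, h3⟩

/-- A linear map sends a layer into a submodule as soon as it does so on the generators. -/
theorem layer_induction {c d : ℕ} {V : Type*} [AddCommGroup V] [Module K V] (T : U n q →ₗ[K] V)
    (S : Submodule K V)
    (hT : ∀ a, c ≤ a → a ≤ d → ∀ i j b, T (F n q ^ a * (e n q i j * E n q ^ b)) ∈ S)
    {x : U n q} (hx : x ∈ layer n q c d) : T x ∈ S := by
  have h1 : layer n q c d ≤ S.comap T := Submodule.span_le.2 fun y hy => by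
    obtain ⟨a, h1, h2, i, j, b, rfl⟩ := hy
    exact hT a h1 h2 i j b
  exact h1 hx

theorem F_mul_mem_layer {c d : ℕ} {x : U n q} (hx : x ∈ layer n q c d) :
    F n q * x ∈ layer n q (c + 1) (d + 1) :=
  layer_induction (LinearMap.mulLeft K (F n q)) _ (fun a hc hd i j b => by
    rw [LinearMap.mulLeft_apply, ← mul_assoc, ← pow_succ']
    exact mem_layer (by omega) (by omega) i j b) hx

theorem exists_F_mul_of_mem_layer {c d : ℕ} {x : U n q} (hx : x ∈ layer n q (c + 1) (d + 1)) :
    ∃ y ∈ layer n q c d, F n q * y = x := by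
  have h := layer_induction (LinearMap.id) ((layer n q c d).map (LinearMap.mulLeft K (F n q)))
    (fun a hc hd i j b => ?_) hx
  · exact h
  · obtain ⟨a, rfl⟩ : ∃ a', a = a' + 1 := ⟨a - 1, by omega⟩
    exact ⟨_, mem_layer (c := c) (d := d) (a := a) (by omega) (by omega) i j b, by
      rw [LinearMap.mulLeft_apply, ← mul_assoc, ← pow_succ']; rfl⟩

/-- Each element of a layer is a combination of powers of `F` with coefficients in `u⁰u⁺`. -/
theorem exists_sum_of_mem_layer {d : ℕ} {x : U n q} (hx : x ∈ layer n q 0 d) :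
    ∃ y : ℕ → U n q, (∀ r, y r ∈ layer n q 0 0) ∧ (∀ r, d < r → y r = 0) ∧
      ∑ r ∈ Finset.range (d + 1), F n q ^ r * y r = x := by
  refine Submodule.span_induction (p := fun x _ => ∃ y : ℕ → U n q, (∀ r, y r ∈ layer n q 0 0) ∧
    (∀ r, d < r → y r = 0) ∧ ∑ r ∈ Finset.range (d + 1), F n q ^ r * y r = x) ?_ ?_ ?_ ?_ hx
  · rintro _ ⟨a, -, hd, i, j, b, rfl⟩
    refine ⟨Pi.single a (e n q i j * E n q ^ b), fun r => ?_, fun r hr => ?_, ?_⟩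
    · rcases eq_or_ne r a with rfl | hra
      · rw [Pi.single_eq_same]
        exact e_mul_E_pow_mem_layer i j b
      · rw [Pi.single_eq_of_ne hra]
        exact zero_mem _
    · exact Pi.single_eq_of_ne (by omega) _
    · rw [Finset.sum_eq_single a, Pi.single_eq_same]
      · intro r _ hra
        rw [Pi.single_eq_of_ne hra, mul_zero]
      · intro h
        exact absurd (Finset.mem_range.2 (by omega)) h
  · exact ⟨0, fun r => zero_mem _, fun _ _ => rfl, by simp⟩
  · rintro _ _ _ _ ⟨y, h1, h2, rfl⟩ ⟨z, h3, h4, rfl⟩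
    exact ⟨y + z, fun r => add_mem (h1 r) (h3 r), fun r hr => by simp [h2 r hr, h4 r hr],
      by simp [mul_add, Finset.sum_add_distrib]⟩
  · rintro c _ _ ⟨y, h1, h2, rfl⟩
    exact ⟨c • y, fun r => Submodule.smul_mem _ _ (h1 r), fun r hr => by simp [h2 r hr],
      by simp [Finset.smul_sum]⟩

/-- Elements that scale both `F` and the idempotents preserve the layers. -/
theorem mul_mem_layer_of_scalar {g : U n q} {z : K} (hg : g * F n q = z • (F n q * g))
    (he : ∀ i j, ∃ r : K, g * e n q i j = r • e n q i j) {c d : ℕ} {x : U n q}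
    (hx : x ∈ layer n q c d) : g * x ∈ layer n q c d :=
  layer_induction (LinearMap.mulLeft K g) _ (fun a hc hd i j b => by
    obtain ⟨r, hr⟩ := he i j
    rw [LinearMap.mulLeft_apply, ← mul_assoc, mul_pow_of_mul hg, smul_mul_assoc, mul_assoc,
      ← mul_assoc g, hr, smul_mul_assoc, mul_smul_comm]
    exact Submodule.smul_mem _ _ (Submodule.smul_mem _ _ (mem_layer hc hd i j b))) hx

end Layer

section Param

variable {K : Type*} [Field K] {n : ℕ} {q : K} (h : IsParam n q)
include h

theorem exists_e_succ_eq (i : ℕ) (j : Fin 2) : ∃ i', e n q i j = e n q (i' + 1) j :=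
  ⟨i + n / 2 * n - 1, by
    rw [Nat.sub_add_cancel (by have := h.half_pos; omega), e_add_half h]⟩

theorem exists_e_fin_eq (i : ℕ) (j : Fin 2) :
    ∃ i' : Fin (n / 2 * n), e n q i j = e n q i' j := by
  refine ⟨⟨i % (n / 2 * n), Nat.mod_lt _ h.half_pos⟩, ?_⟩
  have h1 : ∀ m i, e n q (i + n / 2 * n * m) j = e n q i j := fun m => by
    induction m with
    | zero => simp
    | succ m ih => intro i; rw [mul_add, mul_one, ← add_assoc, e_add_half h, ih]
  conv_lhs => rw [← Nat.mod_add_div i (n / 2 * n), h1]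

theorem E_mul_F_pow_succ (a : ℕ) : E n q * F n q ^ (a + 1) =
    q ^ (a + 1) • (F n q ^ (a + 1) * E n q) -
      (q * qInt q (a + 1)) • (F n q ^ a * (1 - q ^ a • kap n q)) := by
  have hq := h.ne_zero
  -- Up to a scalar, `E` and `F` play symmetric roles.
  have h1 := mul_pow_succ_of_rel (q := q⁻¹) (x := F n q) (y := -q⁻¹ • E n q) (κ := kap n q) ?_ ?_ a
  · rw [inv_inv, smul_mul_assoc, mul_smul_comm] at h1
    have h2 := congrArg (-q • ·) h1
    simp only [smul_smul, smul_add] at h2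
    rw [show -q * -q⁻¹ = 1 by field_simp, one_smul] at h2
    rw [h2]
    generalize F n q ^ a * (1 - q ^ a • kap n q) = z
    match_scalars
    · field_simp
    · ring
  · rw [inv_inv, mul_smul_comm, smul_mul_assoc, smul_smul, F_mul_E]
    match_scalars <;> field_simp <;> ring
  · rw [kap_mul_F h, inv_pow, inv_inv]

theorem E_mul_generator (a i : ℕ) (j : Fin 2) (b : ℕ) :
    ∃ c : K, E n q * (F n q ^ a * (e n q (i + 1) j * E n q ^ b)) =
      q ^ a • (F n q ^ a * (e n q i (j + 1) * E n q ^ (b + 1))) +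
      c • (F n q ^ (a - 1) * (e n q (i + 1) j * E n q ^ b)) ∧ (a = 0 → c = 0) := by
  have h1 : E n q * (e n q (i + 1) j * E n q ^ b) = e n q i (j + 1) * E n q ^ (b + 1) := by
    rw [← mul_assoc, E_mul_e h, mul_assoc, ← pow_succ']
  rcases a with _ | a
  · exact ⟨0, by simp [h1], fun _ => rfl⟩
  · have h2 : (1 - q ^ a • kap n q) * (e n q (i + 1) j * E n q ^ b) =
        (1 - q ^ a * q ^ (2 * (i + 1))) • (e n q (i + 1) j * E n q ^ b) := by
      rw [sub_mul, one_mul, smul_mul_assoc, ← mul_assoc, kap_mul_e h, smul_mul_assoc, smul_smul]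
      module
    refine ⟨-(q * qInt q (a + 1)) * (1 - q ^ a * q ^ (2 * (i + 1))), ?_, fun h0 => by omega⟩
    rw [← mul_assoc, E_mul_F_pow_succ h, sub_mul, smul_mul_assoc, smul_mul_assoc, mul_assoc,
      mul_assoc, h1, h2, mul_smul_comm, smul_smul, Nat.add_sub_cancel, sub_eq_add_neg, ← neg_smul,
      neg_mul]

theorem E_mul_mem_layer {c d : ℕ} {x : U n q} (hx : x ∈ layer n q c d) :
    E n q * x ∈ layer n q (c - 1) d :=
  layer_induction (LinearMap.mulLeft K (E n q)) _ (fun a hc hd i j b => by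
    obtain ⟨i, hi⟩ := exists_e_succ_eq h i j
    obtain ⟨r, hr, -⟩ := E_mul_generator h a i j b
    rw [LinearMap.mulLeft_apply, hi, hr]
    exact add_mem (Submodule.smul_mem _ _ (mem_layer (by omega) hd _ _ _))
      (Submodule.smul_mem _ _ (mem_layer (by omega) (by omega) _ _ _))) hx

theorem k_mul_mem_layer {c d : ℕ} {x : U n q} (hx : x ∈ layer n q c d) :
    k n q * x ∈ layer n q c d :=
  mul_mem_layer_of_scalar (k_mul_F n q) (exists_k_mul_e h) hx

theorem kh_mul_mem_layer {c d : ℕ} {x : U n q} (hx : x ∈ layer n q c d) :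
    kh n q * x ∈ layer n q c d :=
  mul_mem_layer_of_scalar (kh_mul_F n q) (exists_kh_mul_e h) hx

theorem E_pow_mul_mem_layer {c d : ℕ} {x : U n q} (hx : x ∈ layer n q c d) (m : ℕ) :
    E n q ^ m * x ∈ layer n q (c - m) d := by
  induction m with
  | zero => simpa using hx
  | succ m ih =>
    rw [pow_succ', mul_assoc]
    exact E_mul_mem_layer h ih

variable [CharZero K]

theorem uZero_mul_mem_layer {y : U n q} (hy : y ∈ uZero n q) (b : ℕ) :
    y * E n q ^ b ∈ layer n q 0 0 := by
  have h1 : y * E n q ^ b = ∑ i ∈ Finset.range (n / 2 * n), ∑ j, y * (e n q i j * E n q ^ b) := by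
    simp only [← Finset.mul_sum, ← Finset.sum_mul]
    rw [sum_e h, one_mul]
  rw [h1]
  refine sum_mem fun i _ => sum_mem fun j _ => ?_
  obtain ⟨c, hc⟩ := exists_mul_e h hy i j
  rw [← mul_assoc, hc, smul_mul_assoc]
  exact Submodule.smul_mem _ _ (e_mul_E_pow_mem_layer i j b)

theorem lowerPart_eq : lowerPart n q = layer n q 0 (n ^ 2 - 2) := by
  refine le_antisymm (Submodule.span_le.2 ?_) (Submodule.span_le.2 ?_)
  · rintro _ ⟨a, ha, y, hy, z, hz, rfl⟩
    have h1 : ∀ b, F n q ^ a * y * E n q ^ b ∈ layer n q 0 (n ^ 2 - 2) := fun b => by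
      have h2 : ∀ m (x : U n q), x ∈ layer n q 0 0 → F n q ^ m * x ∈ layer n q 0 m := by
        intro m x hx
        induction m with
        | zero => simpa using hx
        | succ m ih =>
          rw [pow_succ', mul_assoc]
          exact layer_mono (Nat.zero_le _) le_rfl (F_mul_mem_layer ih)
      rw [mul_assoc]
      exact layer_mono le_rfl ha (h2 a _ (uZero_mul_mem_layer h hy b))
    have h3 : Subalgebra.toSubmodule (uPlus n q) ≤
        (layer n q 0 (n ^ 2 - 2)).comap (LinearMap.mulLeft K (F n q ^ a * y)) := by
      rw [uPlus, Algebra.adjoin_eq_span, Submodule.span_le]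
      intro z hz
      obtain ⟨b, rfl⟩ := Submonoid.mem_closure_singleton.1 hz
      exact h1 b
    exact h3 hz
  · rintro _ ⟨a, -, ha, i, j, b, rfl⟩
    exact Submodule.subset_span ⟨a, ha, _, e_mem_uZero i j, _, E_pow_mem_uPlus b,
      (mul_assoc _ _ _).symm⟩

omit [CharZero K] h in
/-- A subspace that contains `1` and is stable under left multiplication by the generators is
everything. -/
theorem eq_top_of_generators {S : Submodule K (U n q)} (h1 : 1 ∈ S)
    (hk : ∀ x ∈ S, k n q * x ∈ S) (hkh : ∀ x ∈ S, kh n q * x ∈ S)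
    (hE : ∀ x ∈ S, E n q * x ∈ S) (hF : ∀ x ∈ S, F n q * x ∈ S) : S = ⊤ := by
  refine eq_top_iff.2 fun x _ => ?_
  have hmul : ∀ x : FreeAlgebra K Gen, ∀ y ∈ S, RingQuot.mkAlgHom K (Rel n q) x * y ∈ S := by
    intro x
    induction x using FreeAlgebra.induction with
    | grade0 r =>
      intro y hy
      rw [AlgHom.commutes, ← Algebra.smul_def]
      exact S.smul_mem r hy
    | grade1 g =>
      cases g with
      | k => exact hk
      | kh => exact hkh
      | E => exact hE
      | F => exact hF
    | mul a b ha hb =>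
      intro y hy
      rw [map_mul, mul_assoc]
      exact ha _ (hb y hy)
    | add a b ha hb =>
      intro y hy
      rw [map_add, add_mul]
      exact add_mem (ha y hy) (hb y hy)
  obtain ⟨y, rfl⟩ := RingQuot.mkAlgHom_surjective K (Rel n q) x
  simpa using hmul y 1 h1

theorem layer_eq_top : layer n q 0 (n ^ 2 - 1) = ⊤ := by
  refine eq_top_of_generators ?_ (fun x => k_mul_mem_layer h) (fun x => kh_mul_mem_layer h)
    (fun x hx => by simpa using E_mul_mem_layer h hx) (fun x hx => ?_)
  · have h1 := uZero_mul_mem_layer h (one_mem (uZero n q)) 0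
    rw [one_mul, pow_zero] at h1
    exact layer_mono le_rfl (Nat.zero_le _) h1
  · refine layer_induction (LinearMap.mulLeft K (F n q)) _ (fun a hc hd i j b => ?_) hx
    rw [LinearMap.mulLeft_apply, ← mul_assoc, ← pow_succ']
    rcases eq_or_ne a (n ^ 2 - 1) with rfl | ha
    · rw [F_pow_of_le n q (by omega), zero_mul]
      exact zero_mem _
    · exact mem_layer (by omega) (by omega) i j b

/-- The vectors of the triangular basis. -/
def pbw (n : ℕ) (q : K) (t : Fin (n ^ 2) × Fin (n / 2 * n) × Fin 2 × Fin (n ^ 2)) : U n q :=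
  F n q ^ (t.1 : ℕ) * (e n q t.2.1 t.2.2.1 * E n q ^ (t.2.2.2 : ℕ))

omit [CharZero K] in
/-- The character of `u⁰` with given values at `κ` and at the involution `sgn`. -/
theorem exists_character (i j : ℕ) : ∃ ζ η : K, ζ ^ n = 1 ∧ η ^ n = ζ⁻¹ ^ 2 ∧
    ζ⁻¹ * η = q ^ (2 * i) ∧ η ^ (n / 2) * ζ = (-1) ^ j := by
  have hq := h.ne_zero
  have hn2 : Even n := by rw [← h.half]; exact even_two_mul _
  have hpow : ∀ m, Even m → ((-1 : K) ^ (i + j) * (q ^ (n * i))⁻¹) ^ m = (q ^ (n * m * i))⁻¹ := by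
    intro m hm
    rw [mul_pow, ← pow_mul, mul_comm _ m, pow_mul, hm.neg_one_pow, one_pow, one_mul, inv_pow,
      ← pow_mul, mul_right_comm]
  have h1 : (q ^ (n * i)) ≠ 0 := pow_ne_zero _ hq
  have h0 : (-1 : K) ^ (i + j) * (q ^ (n * i))⁻¹ ≠ 0 :=
    mul_ne_zero (pow_ne_zero _ (neg_ne_zero.2 one_ne_zero)) (inv_ne_zero h1)
  have hN : ((-1 : K) ^ (i + j) * (q ^ (n * i))⁻¹) ^ n = 1 := by
    rw [hpow n hn2, ← sq, pow_mul, h.prim.pow_eq_one, one_pow, inv_one]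
  refine ⟨(-1) ^ (i + j) * (q ^ (n * i))⁻¹, (-1) ^ (i + j) * (q ^ (n * i))⁻¹ * q ^ (2 * i), hN, ?_,
    inv_mul_cancel_left₀ h0 _, ?_⟩
  · rw [mul_pow, hN, one_mul, inv_pow, hpow 2 even_two, inv_inv, ← pow_mul]
    congr 1
    ring
  · rw [mul_pow, hpow _ h.even_half, mul_comm n, pow_mul q (n / 2 * n), h.pow_half, ← pow_mul,
      show 2 * i * (n / 2) = 2 * (n / 2) * i by ring, h.half, pow_add]
    have h2 : ((-1 : K) ^ i)⁻¹ = (-1) ^ i := by rw [← inv_pow, inv_neg_one]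
    rw [h2]
    calc (-1 : K) ^ i * q ^ (n * i) * ((-1) ^ i * (-1) ^ j * (q ^ (n * i))⁻¹)
        = ((-1) * (-1)) ^ i * (-1) ^ j * (q ^ (n * i) * (q ^ (n * i))⁻¹) := by
          rw [mul_pow]; ring
      _ = (-1) ^ j := by rw [mul_inv_cancel₀ h1]; simp

theorem exists_dual_pbw (t : Fin (n ^ 2) × Fin (n / 2 * n) × Fin 2 × Fin (n ^ 2)) :
    ∃ f : U n q →ₗ[K] K, ∀ s, f (pbw n q s) = if s = t then 1 else 0 := by
  obtain ⟨a₀, i₀, j₀, b₀⟩ := t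
  have hq := h.ne_zero
  -- The character on which `e i₀ j₀ * E ^ b₀` does not vanish.
  obtain ⟨ζ, η, hζ, hη, hζη, hηζ⟩ := exists_character h (i₀ + b₀) (j₀ + b₀)
  set ρ := indRep h.prim h.one_lt hζ hη with hρ
  have hE : ∀ b, ρ (E n q ^ b) (indVec K (n ^ 2) 0 0) = indVec K (n ^ 2) 0 b := fun b => by
    rw [map_pow, hρ, indRep_E, indE_pow_indVec h.prim h.one_lt, zero_add]
  have hF : ∀ a b, ρ (F n q ^ a) (indVec K (n ^ 2) 0 b) = indVec K (n ^ 2) a b := fun a b => by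
    rw [map_pow, hρ, indRep_F, indF_pow_indVec, zero_add]
  have hk : ∀ b, ρ (k n q) (indVec K (n ^ 2) 0 b) = (ζ * (q ^ n) ^ b) • indVec K (n ^ 2) 0 b :=
    fun b => by rw [hρ, indRep_k, indK_indVec, pow_zero, mul_one]
  have hkh : ∀ m b, ρ (kh n q ^ m) (indVec K (n ^ 2) 0 b) =
      (η * (q ^ n * (q ^ 2)⁻¹) ^ b) ^ m • indVec K (n ^ 2) 0 b := fun m b => by
    rw [map_pow, hρ, indRep_kh, indKh_pow_indVec, pow_zero, mul_one]
  have hkap : ρ (kap n q) (indVec K (n ^ 2) 0 b₀) = q ^ (2 * (i₀ : ℕ)) • indVec K (n ^ 2) 0 b₀ := by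
    rw [kap, kInv, map_mul, map_pow, hρ, indRep_k, indRep_kh,
      indK_pow_mul_indKh_indVec h.prim h.one_lt hζ]
    congr 1
    rw [hζη, mul_add, pow_add, pow_zero, mul_one, inv_pow, pow_mul q 2 b₀, mul_assoc,
      mul_inv_cancel₀ (pow_ne_zero _ (pow_ne_zero _ hq)), mul_one]
  have hsgn : ρ (sgn n q) (indVec K (n ^ 2) 0 b₀) =
      (-1 : K) ^ (j₀ : ℕ) • indVec K (n ^ 2) 0 b₀ := by
    rw [sgn, map_mul, Module.End.mul_apply, hkh, map_smul, hk, smul_smul]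
    congr 1
    calc (η * (q ^ n * (q ^ 2)⁻¹) ^ (b₀ : ℕ)) ^ (n / 2) * (ζ * (q ^ n) ^ (b₀ : ℕ))
        = (η ^ (n / 2) * ζ) * (q ^ n * (q ^ n * (q ^ 2)⁻¹) ^ (n / 2)) ^ (b₀ : ℕ) := by
          rw [mul_pow, mul_pow, pow_right_comm]; ring
      _ = (-1) ^ (j₀ : ℕ) := by
          rw [hηζ, h.sgn_scalar, ← pow_add, add_assoc, pow_add, ← two_mul, pow_mul (-1 : K) 2]
          simp
  have he0 : ∀ (i : Fin (n / 2 * n)) (j : Fin 2), (i, j) ≠ (i₀, j₀) →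
      ρ (e n q i j) (indVec K (n ^ 2) 0 b₀) = 0 := by
    intro i j hij
    by_contra hne
    have h1 : q ^ (2 * (i : ℕ)) = q ^ (2 * (i₀ : ℕ)) := by
      have := congrArg (fun x => ρ x (indVec K (n ^ 2) 0 b₀)) (e_mul_kap h i j)
      simp only [map_mul, Module.End.mul_apply, hkap, map_smul, LinearMap.smul_apply] at this
      exact (smul_left_injective K hne this).symm
    have h2 : (-1 : K) ^ (j : ℕ) = (-1) ^ (j₀ : ℕ) := by
      have := congrArg (fun x => ρ x (indVec K (n ^ 2) 0 b₀)) (e_mul_sgn h i j)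
      simp only [map_mul, Module.End.mul_apply, hsgn, map_smul, LinearMap.smul_apply] at this
      exact (smul_left_injective K hne this).symm
    refine hij (Prod.ext (Fin.ext (h.sq_pow_inj i.2 i₀.2 h1)) ?_)
    have h3 : (-1 : K) ≠ 1 := by norm_num
    obtain rfl | rfl : j = 0 ∨ j = 1 := by omega
    all_goals obtain h4 | h4 : j₀ = 0 ∨ j₀ = 1 := by omega
    all_goals rw [h4] at h2 ⊢
    · simp [h3.symm] at h2
    · simp [h3] at h2
  have he1 : ρ (e n q i₀ j₀) (indVec K (n ^ 2) 0 b₀) = indVec K (n ^ 2) 0 b₀ := by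
    have := congrArg (fun x => ρ x (indVec K (n ^ 2) 0 b₀)) (sum_e h)
    rw [Finset.sum_range (fun i => ∑ j, e n q i j), ← Fintype.sum_prod_type'] at this
    simp only [map_sum, map_one, LinearMap.sum_apply, Module.End.one_apply] at this
    rwa [Finset.sum_eq_single (i₀, j₀) (fun x _ hx => he0 x.1 x.2 hx)
      (fun hx => absurd (Finset.mem_univ _) hx)] at this
  refine ⟨LinearMap.proj (a₀, b₀) ∘ₗ LinearMap.applyₗ (indVec K (n ^ 2) 0 0) ∘ₗ ρ.toLinearMap, ?_⟩
  rintro ⟨a, i, j, b⟩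
  have hval : ∀ a b : Fin (n ^ 2), indVec K (n ^ 2) a b (a₀, b₀) = if a = a₀ ∧ b =
      b₀ then 1 else 0 := by
    intro a b
    rw [← basisFun_eq_indVec (a, b), Pi.basisFun_apply, Pi.single_apply]
    simp [eq_comm]
  have hgoal : ρ (pbw n q (a, i, j, b)) (indVec K (n ^ 2) 0 0) (a₀, b₀) =
      if (a, i, j, b) = (a₀, i₀, j₀, b₀) then 1 else 0 := by
    simp only [pbw, map_mul, Module.End.mul_apply, hE]
    by_cases hb : b = b₀
    · subst hb
      by_cases hij : (i, j) = (i₀, j₀)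
      · obtain ⟨rfl, rfl⟩ := Prod.mk.inj hij
        rw [he1, hF, hval]
        simp
      · rw [he0 i j hij, map_zero, Pi.zero_apply, if_neg]
        rintro h'
        simp only [Prod.mk.injEq] at h' hij
        tauto
    · obtain ⟨c, hc⟩ := exists_smul_of_mem_uZero ρ ⟨_, hk b⟩ ⟨_, by simpa using hkh 1 b⟩
        (e_mem_uZero i j)
      rw [hc, map_smul, hF, Pi.smul_apply, hval, if_neg (by tauto), smul_zero, if_neg]
      simp only [Prod.mk.injEq]
      tauto
  exact hgoal

theorem linearIndependent_pbw : LinearIndependent K (pbw n q) := by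
  rw [Fintype.linearIndependent_iff]
  intro g hg t
  obtain ⟨f, hf⟩ := exists_dual_pbw h t
  have h1 := congrArg f hg
  simpa [map_sum, hf] using h1

theorem span_range_pbw : Submodule.span K (Set.range (pbw n q)) = ⊤ := by
  rw [← layer_eq_top h]
  refine le_antisymm (Submodule.span_le.2 ?_) (Submodule.span_le.2 ?_)
  · rintro _ ⟨t, rfl⟩
    exact mem_layer (Nat.zero_le _) (by have := t.1.2; omega) _ _ _
  · rintro _ ⟨a, -, ha, i, j, b, rfl⟩
    by_cases hb : b < n ^ 2
    · obtain ⟨i', hi'⟩ := exists_e_fin_eq h i j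
      rw [hi']
      exact Submodule.subset_span ⟨(⟨a, by have := h.one_lt_sq; omega⟩, i', j, ⟨b, hb⟩), rfl⟩
    · rw [E_pow_of_le n q (by omega), mul_zero, mul_zero]
      exact zero_mem _

theorem finite_U : Module.Finite K (U n q) :=
  Module.Finite.of_basis (Module.Basis.mk (linearIndependent_pbw h) (span_range_pbw h).ge)

theorem finrank_U : Module.finrank K (U n q) = n ^ 2 * (n / 2 * n * (2 * n ^ 2)) := by
  rw [Module.finrank_eq_card_basis
    (Module.Basis.mk (linearIndependent_pbw h) (span_range_pbw h).ge)]
  simp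

theorem F_pow_injOn_layer {w : U n q} (hw : w ∈ layer n q 0 0)
    (hw0 : F n q ^ (n ^ 2 - 1) * w = 0) : w = 0 := by
  have hN := h.one_lt_sq
  let z : Fin (n / 2 * n) × Fin 2 × Fin (n ^ 2) → U n q :=
    fun t => e n q t.1 t.2.1 * E n q ^ (t.2.2 : ℕ)
  have h1 : w ∈ Submodule.span K (Set.range z) := by
    refine Submodule.span_le.2 ?_ hw
    rintro _ ⟨a, -, ha, i, j, b, rfl⟩
    obtain rfl : a = 0 := by omega
    rw [pow_zero, one_mul]
    by_cases hb : b < n ^ 2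
    · obtain ⟨i', hi'⟩ := exists_e_fin_eq h i j
      rw [hi']
      exact Submodule.subset_span ⟨(i', j, ⟨b, hb⟩), rfl⟩
    · rw [E_pow_of_le n q (by omega), mul_zero]
      exact zero_mem _
  obtain ⟨c, rfl⟩ := (Submodule.mem_span_range_iff_exists_fun K).1 h1
  have h2 := (linearIndependent_pbw h).comp
    (fun t => ((⟨n ^ 2 - 1, by omega⟩ : Fin (n ^ 2)), t)) (fun s t hst => (Prod.mk.inj hst).2)
  have h3 := Fintype.linearIndependent_iff.1 h2 c (by
    rw [Finset.mul_sum] at hw0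
    simpa [pbw, z, mul_smul_comm] using hw0)
  simp [h3]

/-- `u` is free over the algebra generated by `F`, with `u⁰u⁺` as a space of generators. -/
theorem coeff_eq_zero {y : ℕ → U n q} (hy : ∀ r, y r ∈ layer n q 0 0) {s : ℕ}
    (hs : F n q ^ s * ∑ r ∈ Finset.range (n ^ 2), F n q ^ r * y r = 0) {r : ℕ}
    (hr : r + s < n ^ 2) : y r = 0 := by
  have hp : ∀ m (x : U n q), (LinearMap.mulLeft K (F n q) ^ m) x = F n q ^ m * x := fun m x => by
    rw [LinearMap.pow_mulLeft, LinearMap.mulLeft_apply]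
  refine eq_zero_of_pow_sum_eq_zero (T := LinearMap.mulLeft K (F n q)) (W := layer n q 0 0) ?_ ?_
    hy (s := s) ?_ hr
  · rw [LinearMap.pow_mulLeft, F_pow, LinearMap.mulLeft_zero_eq_zero]
  · intro w hw hw0
    rw [hp] at hw0
    exact F_pow_injOn_layer h hw hw0
  · simpa only [hp] using hs

theorem eq_zero_of_mem_lowerPart {x : U n q} (hx : x ∈ lowerPart n q) (hF : F n q * x = 0) :
    x = 0 := by
  have hN := h.one_lt_sq
  rw [lowerPart_eq h] at hx
  obtain ⟨y, hy, hy0, rfl⟩ := exists_sum_of_mem_layer hx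
  have h1 : ∑ r ∈ Finset.range (n ^ 2), F n q ^ r * y r =
      ∑ r ∈ Finset.range (n ^ 2 - 2 + 1), F n q ^ r * y r := by
    rw [show n ^ 2 = n ^ 2 - 2 + 1 + 1 by omega, Finset.sum_range_succ]
    rw [hy0 _ (by omega), mul_zero, add_zero]
    rfl
  refine Finset.sum_eq_zero fun r hr => ?_
  have hr := Finset.mem_range.1 hr
  rw [coeff_eq_zero h hy (s := 1) (by rw [h1, pow_one, hF]) (by omega), mul_zero]

theorem exists_F_mul_of_pow_mul_eq_zero {x : U n q} (hx : F n q ^ (n ^ 2 - 1) * x = 0) :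
    ∃ y, F n q * y = x := by
  have hN := h.one_lt_sq
  have hx' : x ∈ layer n q 0 (n ^ 2 - 1) := by rw [layer_eq_top h]; trivial
  obtain ⟨y, hy, hy0, hsum⟩ := exists_sum_of_mem_layer hx'
  rw [Nat.sub_add_cancel hN.le] at hsum
  have h1 : y 0 = 0 := coeff_eq_zero h hy (s := n ^ 2 - 1) (by rw [hsum, hx]) (by omega)
  refine ⟨∑ r ∈ Finset.range (n ^ 2 - 1), F n q ^ r * y (r + 1), ?_⟩
  rw [← hsum, ← Nat.sub_add_cancel hN.le, Finset.sum_range_succ', h1, mul_zero, add_zero,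
    Finset.mul_sum, Nat.add_sub_cancel]
  exact Finset.sum_congr rfl fun r _ => by rw [← mul_assoc, ← pow_succ']

end Param

/-! ### The strings through `α` and `γ` -/

section Param

variable {K : Type*} [Field K] {n : ℕ} {q : K} (h : IsParam n q)
include h

theorem F_mul_E_pow_succ_mul {x : U n q} {μ : K} (hx : kap n q * x = μ • x) (a : ℕ) :
    F n q * (E n q ^ (a + 1) * x) = q⁻¹ ^ (a + 1) • (E n q ^ (a + 1) * (F n q * x)) +
      (qInt q⁻¹ (a + 1) * (1 - q⁻¹ ^ a * μ)) • (E n q ^ a * x) := by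
  rw [← mul_assoc, F_mul_E_pow_succ n q (kap_mul_E h), add_mul, smul_mul_assoc, smul_mul_assoc,
    mul_assoc, mul_assoc, sub_mul, one_mul, smul_mul_assoc, hx, mul_sub, mul_smul_comm,
    mul_smul_comm]
  module

theorem F_mul_alpha (i : ℕ) (j : Fin 2) : F n q * alpha n q i j = 0 := by
  rw [alpha, ← mul_assoc, ← pow_succ', Nat.sub_add_cancel h.one_lt_sq.le, F_pow, zero_mul]

theorem kap_mul_alpha {i : ℕ} (hi : 1 ≤ i) (j : Fin 2) :
    kap n q * alpha n q i j = q ^ (2 * i - 2) • alpha n q i j := by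
  have hN := h.one_lt_sq
  rw [alpha, ← mul_assoc, mul_pow_of_mul (kap_mul_F h), smul_mul_assoc, mul_assoc, kap_mul_e h,
    mul_smul_comm, smul_smul]
  congr 1
  rw [← pow_mul, ← pow_add, show 2 * (n ^ 2 - 1) + 2 * i = n ^ 2 * 2 + (2 * i - 2) by omega,
    pow_add,
    pow_mul, h.prim.pow_eq_one, one_pow, one_mul]

/-- The coefficient of `F` on the string through `α` vanishes only at the start of the submodule
generated by `E ^ (2 * i - 1) α`. -/
theorem alpha_coeff_ne_zero {i : ℕ} (hi : 2 * i ≤ n ^ 2) {a : ℕ} (ha : a + 1 < n ^ 2)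
    (hai : a ≠ 2 * i - 2) : qInt q⁻¹ (a + 1) * (1 - q⁻¹ ^ a * q ^ (2 * i - 2)) ≠ 0 := by
  have hq := h.ne_zero
  refine mul_ne_zero (qInt_ne_zero h.prim.inv (Nat.succ_pos a) ha) fun h0 => hai ?_
  refine h.prim.pow_inj (by omega) (by omega) ?_
  rw [sub_eq_zero, inv_pow, eq_comm, inv_mul_eq_one₀ (pow_ne_zero _ hq)] at h0
  exact h0

theorem F_mul_E_pow_succ_mul_alpha {i : ℕ} (hi : 1 ≤ i) (j : Fin 2) (a : ℕ) :
    F n q * (E n q ^ (a + 1) * alpha n q i j) =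
      (qInt q⁻¹ (a + 1) * (1 - q⁻¹ ^ a * q ^ (2 * i - 2))) • (E n q ^ a * alpha n q i j) := by
  rw [F_mul_E_pow_succ_mul h (kap_mul_alpha h hi j), F_mul_alpha h, mul_zero, smul_zero, zero_add]

/-- `E ^ (2 * i - 1) α` is again killed by `F`. -/
theorem F_mul_E_pow_mul_alpha_eq_zero {i : ℕ} (hi : 1 ≤ i) (j : Fin 2) :
    F n q * (E n q ^ (2 * i - 1) * alpha n q i j) = 0 := by
  have hq := h.ne_zero
  have h1 := F_mul_E_pow_succ_mul_alpha h hi j (2 * i - 2)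
  rw [show 2 * i - 2 + 1 = 2 * i - 1 by omega] at h1
  rw [h1, inv_pow, inv_mul_cancel₀ (pow_ne_zero _ hq), sub_self, mul_zero, zero_smul]

theorem exists_F_pow_mul_alpha {i : ℕ} (hi : 1 ≤ i) (hi2 : 2 * i ≤ n ^ 2) (j : Fin 2) (a r : ℕ) :
    ∃ c : K, F n q ^ r * (E n q ^ (a + r) * alpha n q i j) = c • (E n q ^ a * alpha n q i j) ∧
      (a + r < n ^ 2 → 2 * i - 2 < a ∨ a + r ≤ 2 * i - 2 → c ≠ 0) := by
  induction r with
  | zero => exact ⟨1, by simp, fun _ _ => one_ne_zero⟩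
  | succ r ih =>
    obtain ⟨c, hc, hc0⟩ := ih
    refine ⟨_, by rw [pow_succ, mul_assoc, ← add_assoc, F_mul_E_pow_succ_mul_alpha h hi,
      mul_smul_comm, hc, smul_smul], fun h1 h2 => ?_⟩
    exact mul_ne_zero (alpha_coeff_ne_zero h hi2 (by omega) (by omega)) (hc0 (by omega) (by omega))

variable [CharZero K]

theorem existsUnique_gamma {i : ℕ} (hi : 1 ≤ i) (hi2 : 2 * i ≤ n ^ 2) (j : Fin 2) :
    ∃! g, IsGamma n q i j g := by
  have hN := h.one_lt_sq
  have h1 : alpha n q i j ∈ layer n q (n ^ 2 - 1) (n ^ 2 - 1) := by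
    have := mem_layer (n := n) (q := q) (le_refl (n ^ 2 - 1)) (le_refl (n ^ 2 - 1)) i j 0
    rwa [pow_zero, mul_one] at this
  have h2 : beta n q i j ∈ layer n q (0 + 1) (n ^ 2 - 2 + 1) :=
    layer_mono (by omega) (by omega) (E_pow_mul_mem_layer h h1 (2 * i - 2))
  obtain ⟨g, hg, hFg⟩ := exists_F_mul_of_mem_layer h2
  rw [← lowerPart_eq h] at hg
  refine ⟨g, ⟨hg, hFg⟩, fun g' hg' => sub_eq_zero.1 ?_⟩
  exact eq_zero_of_mem_lowerPart h (sub_mem hg'.1 hg) (by rw [mul_sub, hg'.2, hFg, sub_self])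

variable {i : ℕ} {j : Fin 2} {g : U n q}

/-- An element that scales `F` and the idempotents scales `γ` as soon as it scales `β`, since `F`
is injective on `lowerPart`. -/
theorem mul_gamma_of_scalar (hg : IsGamma n q i j g) {x : U n q} {z r : K} (hz : z ≠ 0)
    (hF : x * F n q = z • (F n q * x)) (he : ∀ i j, ∃ c : K, x * e n q i j = c • e n q i j)
    (hβ : x * beta n q i j = r • beta n q i j) : x * g = (z⁻¹ * r) • g := by
  refine sub_eq_zero.1 (eq_zero_of_mem_lowerPart h (sub_mem ?_ (Submodule.smul_mem _ _ hg.1)) ?_)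
  · have h1 := hg.1
    rw [lowerPart_eq h] at h1 ⊢
    exact mul_mem_layer_of_scalar hF he h1
  · have h1 : F n q * x = z⁻¹ • (x * F n q) := by rw [hF, smul_smul, inv_mul_cancel₀ hz, one_smul]
    rw [mul_sub, ← mul_assoc, h1, smul_mul_assoc, mul_assoc, hg.2, hβ, mul_smul_comm, hg.2,
      smul_smul, sub_self]

theorem kap_mul_gamma (hi : 1 ≤ i) (hg : IsGamma n q i j g) :
    kap n q * g = q⁻¹ ^ (2 * i) • g := by
  have hq := h.ne_zero
  obtain ⟨i, rfl⟩ : ∃ i', i = i' + 1 := ⟨i - 1, by omega⟩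
  have hβ : kap n q * beta n q (i + 1) j = q⁻¹ ^ (2 * i) • beta n q (i + 1) j := by
    rw [beta, ← mul_assoc, mul_pow_of_mul (kap_mul_E h), smul_mul_assoc, mul_assoc,
      kap_mul_alpha h hi, mul_smul_comm, smul_smul]
    congr 1
    rw [show 2 * (i + 1) - 2 = 2 * i by omega, inv_pow, ← pow_mul, two_mul (2 * i), pow_add,
      mul_inv,
      mul_assoc, inv_mul_cancel₀ (pow_ne_zero _ hq), mul_one, inv_pow]
  rw [mul_gamma_of_scalar h hg (pow_ne_zero 2 hq) (kap_mul_F h) (fun i j => ⟨_,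
    kap_mul_e h i j⟩) hβ]
  congr 1
  rw [← inv_pow, ← pow_add]
  congr 1
  ring

theorem exists_k_mul_gamma (hg : IsGamma n q i j g) : ∃ c : K, k n q * g = c • g := by
  have hq := h.ne_zero
  obtain ⟨c, hc⟩ := exists_k_mul_e h i j
  exact ⟨_, mul_gamma_of_scalar h hg (inv_ne_zero (pow_ne_zero n hq)) (k_mul_F n q)
    (exists_k_mul_e h) (by
      rw [beta, alpha, ← mul_assoc, mul_pow_of_mul (k_mul_E n q), smul_mul_assoc, mul_assoc,
        ← mul_assoc (k n q), mul_pow_of_mul (k_mul_F n q), smul_mul_assoc, mul_assoc, hc,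
        mul_smul_comm, mul_smul_comm, mul_smul_comm, smul_smul, smul_smul])⟩

theorem exists_kh_mul_gamma (hg : IsGamma n q i j g) (hi : 1 ≤ i) :
    ∃ c : K, kh n q * g = c • g := by
  obtain ⟨c, hc⟩ := exists_k_mul_gamma h hg
  exact ⟨_, by rw [kh_eq h, mul_assoc, kap_mul_gamma h hi hg, mul_smul_comm, hc, smul_smul]⟩

theorem F_mul_E_pow_succ_mul_gamma (hi : 1 ≤ i) (hg : IsGamma n q i j g) (a : ℕ) :
    F n q * (E n q ^ (a + 1) * g) = q⁻¹ ^ (a + 1) • (E n q ^ (2 * i - 1 + a) * alpha n q i j) +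
      (qInt q⁻¹ (a + 1) * (1 - q⁻¹ ^ a * q⁻¹ ^ (2 * i))) • (E n q ^ a * g) := by
  rw [F_mul_E_pow_succ_mul h (kap_mul_gamma h hi hg), hg.2, beta, ← mul_assoc, ← pow_add,
    show a + 1 + (2 * i - 2) = 2 * i - 1 + a by omega]

omit [CharZero K] in
theorem gamma_coeff_ne_zero (hi : 1 ≤ i) (hi2 : 2 * i ≤ n ^ 2) {a : ℕ} (ha : a + 1 < n ^ 2)
    (hai : a ≠ n ^ 2 - 2 * i) : qInt q⁻¹ (a + 1) * (1 - q⁻¹ ^ a * q⁻¹ ^ (2 * i)) ≠ 0 := by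
  refine mul_ne_zero (qInt_ne_zero h.prim.inv (Nat.succ_pos a) ha) fun h0 => hai ?_
  rw [← pow_add, sub_eq_zero, eq_comm, h.prim.inv.pow_eq_one_iff_dvd] at h0
  obtain ⟨m, hm⟩ := h0
  obtain rfl | rfl | hm2 : m = 0 ∨ m = 1 ∨ 2 ≤ m := by omega
  · omega
  · omega
  · have := Nat.mul_le_mul_left (n ^ 2) hm2
    omega

/-- The chain of the head of `u γ`, which ends in `α`. -/
theorem exists_F_pow_mul_gamma_eq_alpha (hi : 1 ≤ i) (hi2 : 2 * i ≤ n ^ 2)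
    (hg : IsGamma n q i j g) :
    ∃ c : K, c ≠ 0 ∧ F n q ^ (n ^ 2 - 1) * (E n q ^ (n ^ 2 - 2 * i) * g) = c • alpha n q i j := by
  have h1 : ∀ r, r ≤ n ^ 2 - 2 * i → ∃ c d : K, c ≠ 0 ∧
      F n q ^ r * (E n q ^ r * g) = c • g + d • (E n q ^ (2 * i - 1) * alpha n q i j) := by
    intro r hr
    induction r with
    | zero => exact ⟨1, 0, one_ne_zero, by simp⟩
    | succ r ih =>
      obtain ⟨c, d, hc, hcd⟩ := ih (by omega)
      obtain ⟨b, hb, -⟩ := exists_F_pow_mul_alpha h hi hi2 j (2 * i - 1) r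
      have hne := gamma_coeff_ne_zero h hi hi2 (a := r) (by omega) (by omega)
      refine ⟨_, q⁻¹ ^ (r + 1) * b + (qInt q⁻¹ (r + 1) * (1 - q⁻¹ ^ r * q⁻¹ ^ (2 * i))) * d,
        mul_ne_zero hne hc, ?_⟩
      rw [pow_succ, mul_assoc, F_mul_E_pow_succ_mul_gamma h hi hg, mul_add, mul_smul_comm,
        mul_smul_comm, hb, hcd]
      module
  obtain ⟨c, d, hc, hcd⟩ := h1 _ le_rfl
  obtain ⟨b, hb, hb0⟩ := exists_F_pow_mul_alpha h hi hi2 j 0 (2 * i - 2)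
  refine ⟨c * b, mul_ne_zero hc (hb0 (by omega) (by omega)), ?_⟩
  rw [zero_add, pow_zero, one_mul] at hb
  rw [show n ^ 2 - 1 = (2 * i - 2) + 1 + (n ^ 2 - 2 * i) by omega, pow_add, mul_assoc, hcd,
    pow_succ,
    mul_assoc, mul_add, mul_smul_comm, mul_smul_comm, F_mul_E_pow_mul_alpha_eq_zero h hi, smul_zero,
    add_zero, hg.2, beta, mul_smul_comm, hb, smul_smul]

/-- The chain that ends in the generator `E ^ (2 * i - 1) α` of the socle of `u γ`. -/
theorem exists_F_pow_mul_gamma_eq_socle (hi : 1 ≤ i) (hi2 : 2 * i ≤ n ^ 2)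
    (hg : IsGamma n q i j g) :
    ∃ c : K, c ≠ 0 ∧ F n q ^ (n ^ 2 - 1) * (E n q ^ (n ^ 2 - 1) * g) =
      c • (E n q ^ (2 * i - 1) * alpha n q i j) := by
  have hq := h.ne_zero
  have h1 : ∀ r, r ≤ 2 * i - 2 → ∃ c : K, c ≠ 0 ∧
      F n q ^ r * (E n q ^ (n ^ 2 - 2 * i + 1 + r) * g) =
          c • (E n q ^ (n ^ 2 - 2 * i + 1) * g) := by
    intro r hr
    induction r with
    | zero => exact ⟨1, one_ne_zero, by simp⟩
    | succ r ih =>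
      obtain ⟨c, hc, hcd⟩ := ih (by omega)
      refine ⟨_, mul_ne_zero (gamma_coeff_ne_zero h hi hi2 (a := n ^ 2 - 2 * i + 1 + r) (by omega)
        (by omega)) hc, ?_⟩
      rw [pow_succ (F n q), mul_assoc, ← add_assoc, F_mul_E_pow_succ_mul_gamma h hi hg,
        E_pow_of_le n q (a := 2 * i - 1 + _) (by omega), zero_mul, smul_zero, zero_add,
        mul_smul_comm, hcd, smul_smul]
  obtain ⟨c, hc, hcd⟩ := h1 _ le_rfl
  obtain ⟨b, hb, hb0⟩ := exists_F_pow_mul_alpha h hi hi2 j (2 * i - 1) (n ^ 2 - 2 * i)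
  refine ⟨c * (q⁻¹ ^ (n ^ 2 - 2 * i + 1) * b), mul_ne_zero hc (mul_ne_zero
    (pow_ne_zero _ (inv_ne_zero hq)) (hb0 (by omega) (by omega))), ?_⟩
  have h2 : q⁻¹ ^ (n ^ 2 - 2 * i) * q⁻¹ ^ (2 * i) = 1 := by
    rw [← pow_add, Nat.sub_add_cancel hi2, h.prim.inv.pow_eq_one]
  nth_rewrite 1 [show n ^ 2 - 1 = (n ^ 2 - 2 * i) + 1 + (2 * i - 2) by omega]
  rw [show n ^ 2 - 1 = n ^ 2 - 2 * i + 1 + (2 * i - 2) by omega, pow_add (F n q), mul_assoc, hcd,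
    pow_succ (F n q), mul_assoc, mul_smul_comm, F_mul_E_pow_succ_mul_gamma h hi hg, h2, sub_self,
    mul_zero, zero_smul, add_zero, mul_smul_comm, mul_smul_comm, hb, smul_smul, smul_smul,
    mul_assoc]

theorem E_pow_mul_F_pow_last_mul_e (a l : ℕ) (j : Fin 2) : ∃ c : K, c ≠ 0 ∧
    E n q ^ a * (F n q ^ (n ^ 2 - 1) * e n q (l + a) j) -
      c • (F n q ^ (n ^ 2 - 1) * (e n q l (j + a • 1) * E n q ^ a)) ∈ layer n q 0 (n ^ 2 - 2) := by
  have hq := h.ne_zero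
  have hN := h.one_lt_sq
  induction a generalizing l with
  | zero => exact ⟨1, one_ne_zero, by simp⟩
  | succ a ih =>
    obtain ⟨c, hc, hmem⟩ := ih (l + 1)
    obtain ⟨d, hd, -⟩ := E_mul_generator h (n ^ 2 - 1) l (j + a • 1) a
    refine ⟨c * q ^ (n ^ 2 - 1), mul_ne_zero hc (pow_ne_zero _ hq), ?_⟩
    have h1 := E_mul_mem_layer h hmem
    rw [mul_sub, mul_smul_comm, hd, ← mul_assoc, ← pow_succ', smul_add, ← sub_sub, smul_smul,
      add_assoc l, add_comm 1 a, add_assoc j] at h1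
    rw [succ_nsmul]
    refine (Submodule.sub_mem_iff_left _ ?_).1 h1
    exact Submodule.smul_mem _ _ (Submodule.smul_mem _ _ (mem_layer (by omega) (by omega) _ _ _))

/-- The generator of the socle of `u γ` in the triangular basis. -/
theorem exists_E_pow_mul_alpha_eq (hi : 1 ≤ i) (hi2 : 2 * i ≤ n ^ 2) (j : Fin 2) :
    ∃ c : K, c ≠ 0 ∧ E n q ^ (2 * i - 1) * alpha n q i j = c • (F n q ^ (n ^ 2 - 1) *
      (e n q (n / 2 * n + 1 - i) (j + 1) * E n q ^ (2 * i - 1))) := by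
  have hM := h.two_mul_half
  obtain ⟨c, hc, hmem⟩ := E_pow_mul_F_pow_last_mul_e h (2 * i - 1) (n / 2 * n + 1 - i) j
  rw [show n / 2 * n + 1 - i + (2 * i - 1) = i + n / 2 * n by omega, e_add_half h, ← alpha,
    ← lowerPart_eq h, show (2 * i - 1) • (1 : Fin 2) = 1 by
      obtain ⟨i, rfl⟩ : ∃ i', i = i' + 1 := ⟨i - 1, by omega⟩
      rw [show 2 * (i + 1) - 1 = i * 2 + 1 by omega, succ_nsmul, mul_nsmul',
        show 2 • (1 : Fin 2) = 0 from rfl, nsmul_zero, zero_add]] at hmem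
  refine ⟨c, hc, sub_eq_zero.1 (eq_zero_of_mem_lowerPart h hmem ?_)⟩
  rw [mul_sub, F_mul_E_pow_mul_alpha_eq_zero h hi, mul_smul_comm, ← mul_assoc, ← pow_succ',
    F_pow_of_le n q (by omega), zero_mul, smul_zero, sub_zero]

theorem e_mul_E_pow_ne_zero (i : ℕ) (j : Fin 2) {b : ℕ} (hb : b < n ^ 2) :
    e n q i j * E n q ^ b ≠ 0 := by
  obtain ⟨i', hi'⟩ := exists_e_fin_eq h i j
  have h1 := (linearIndependent_pbw h).ne_zero
    (⟨0, by have := h.one_lt_sq; omega⟩, i', j, ⟨b, hb⟩)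
  rw [hi']
  simpa [pbw] using h1

theorem alpha_pair_eq_zero (hi : 1 ≤ i) (hi2 : 2 * i ≤ n ^ 2) {a b : K}
    (hab : a • alpha n q i j + b • (E n q ^ (2 * i - 1) * alpha n q i j) = 0) : a = 0 ∧ b = 0 := by
  have hN := h.one_lt_sq
  obtain ⟨c, hc, hw⟩ := exists_E_pow_mul_alpha_eq h hi hi2 j
  set l := n / 2 * n + 1 - i
  have h1 : a • e n q i j + (b * c) • (e n q l (j + 1) * E n q ^ (2 * i - 1)) = 0 := by
    refine F_pow_injOn_layer h (add_mem (Submodule.smul_mem _ _ ?_)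
      (Submodule.smul_mem _ _ (e_mul_E_pow_mem_layer _ _ _))) ?_
    · have := e_mul_E_pow_mem_layer (n := n) (q := q) i j 0
      rwa [pow_zero, mul_one] at this
    · rw [mul_add, mul_smul_comm, mul_smul_comm, mul_smul, ← hw, ← alpha, hab]
  -- Multiplication by `E ^ (n ^ 2 - 1)` on the right isolates the first term.
  have ha : a = 0 := by
    have h2 := congrArg (· * E n q ^ (n ^ 2 - 1)) h1
    simp only [add_mul, smul_mul_assoc, mul_assoc, ← pow_add, zero_mul] at h2
    rw [E_pow_of_le n q (a := 2 * i - 1 + _) (by omega), mul_zero, smul_zero, add_zero] at h2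
    exact (smul_eq_zero.1 h2).resolve_right (e_mul_E_pow_ne_zero h i j (by omega))
  refine ⟨ha, ?_⟩
  rw [ha, zero_smul, zero_add] at h1
  have h2 := (smul_eq_zero.1 h1).resolve_right (e_mul_E_pow_ne_zero h _ _ (by omega))
  exact (mul_eq_zero.1 h2).resolve_right hc

end Param

section Param

variable {K : Type*} [Field K] {n : ℕ} {q : K} (h : IsParam n q) [CharZero K] {i : ℕ} {j : Fin 2}
  {g : U n q}

/-! ### The left ideals `u γ` and their socles -/

/-- A spanning family of `u γ`, consisting of the vectors `E ^ a γ` and `E ^ a α`. -/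
def gammaFam (i : ℕ) (j : Fin 2) (g : U n q) : Fin 2 × Fin (n ^ 2) → U n q :=
  fun t => E n q ^ (t.2 : ℕ) * if t.1 = 0 then g else alpha n q i j

/-- The `2 n ^ 2` vectors of the two `F`-chains in `u γ`, from `E ^ (n ^ 2 - 2 * i) γ` and from
`E ^ (n ^ 2 - 1) γ`. -/
def chainFam (i : ℕ) (g : U n q) : Fin (n ^ 2) × Fin 2 → U n q :=
  fun p => F n q ^ (p.1 : ℕ) * (E n q ^ (if p.2 = 0 then n ^ 2 - 2 * i else n ^ 2 - 1) * g)

omit [CharZero K] in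
theorem mul_mem_leftIdeal (x : U n q) : x * g ∈ leftIdeal n q g :=
  Submodule.smul_mem _ x (Submodule.mem_span_singleton_self g)

omit [CharZero K] in
theorem exists_of_mem_leftIdeal {y : U n q} (hy : y ∈ leftIdeal n q g) : ∃ x, x * g = y :=
  Submodule.mem_span_singleton.1 hy

omit [CharZero K] in
theorem E_pow_mul_gamma_mem_span (a : ℕ) :
    E n q ^ a * g ∈ Submodule.span K (Set.range (gammaFam i j g)) := by
  by_cases ha : a < n ^ 2
  · exact Submodule.subset_span ⟨(0, ⟨a, ha⟩), by simp [gammaFam]⟩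
  · rw [E_pow_of_le n q (by omega), zero_mul]
    exact zero_mem _

omit [CharZero K] in
theorem E_pow_mul_alpha_mem_span (a : ℕ) :
    E n q ^ a * alpha n q i j ∈ Submodule.span K (Set.range (gammaFam i j g)) := by
  by_cases ha : a < n ^ 2
  · exact Submodule.subset_span ⟨(1, ⟨a, ha⟩), by simp [gammaFam]⟩
  · rw [E_pow_of_le n q (by omega), zero_mul]
    exact zero_mem _

include h

theorem leftIdeal_le_span (hi : 1 ≤ i) (hg : IsGamma n q i j g) :
    (leftIdeal n q g).restrictScalars K ≤ Submodule.span K (Set.range (gammaFam i j g)) := by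
  set Q := Submodule.span K (Set.range (gammaFam i j g)) with hQ
  have hgen : ∀ x : U n q, (∀ a, x * (E n q ^ a * g) ∈ Q) →
      (∀ a, x * (E n q ^ a * alpha n q i j) ∈ Q) → ∀ y ∈ Q, x * y ∈ Q := by
    intro x h1 h2 y hy
    have h3 : Q ≤ Q.comap (LinearMap.mulLeft K x) := by
      rw [hQ, Submodule.span_le]
      rintro _ ⟨⟨t, a⟩, rfl⟩
      by_cases ht : t = 0
      · simpa [gammaFam, ht] using h1 a
      · simpa [gammaFam, ht] using h2 a
    exact h3 hy
  have hscal : ∀ (x : U n q) (z : K), x * E n q = z • (E n q * x) → (∃ c : K, x * g = c • g) →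
      (∃ c : K, x * alpha n q i j = c • alpha n q i j) → ∀ y ∈ Q, x * y ∈ Q := by
    rintro x z hx ⟨c, hc⟩ ⟨d, hd⟩
    refine hgen x (fun a => ?_) (fun a => ?_)
    · rw [← mul_assoc, mul_pow_of_mul hx, smul_mul_assoc, mul_assoc, hc, mul_smul_comm]
      exact Q.smul_mem _ (Q.smul_mem _ (E_pow_mul_gamma_mem_span a))
    · rw [← mul_assoc, mul_pow_of_mul hx, smul_mul_assoc, mul_assoc, hd, mul_smul_comm]
      exact Q.smul_mem _ (Q.smul_mem _ (E_pow_mul_alpha_mem_span a))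
  have hka : ∃ c : K, k n q * alpha n q i j = c • alpha n q i j := by
    obtain ⟨c, hc⟩ := exists_k_mul_e h i j
    exact ⟨_, by rw [alpha, ← mul_assoc, mul_pow_of_mul (k_mul_F n q), smul_mul_assoc, mul_assoc,
      hc,
      mul_smul_comm, smul_smul]⟩
  have hkha : ∃ c : K, kh n q * alpha n q i j = c • alpha n q i j := by
    obtain ⟨c, hc⟩ := hka
    exact ⟨_, by rw [kh_eq h, mul_assoc, kap_mul_alpha h hi, mul_smul_comm, hc, smul_smul]⟩
  have htop : Q.comap (LinearMap.mulRight K g) = ⊤ := by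
    refine eq_top_of_generators ?_ (fun x hx => ?_) (fun x hx => ?_) (fun x hx => ?_)
      (fun x hx => ?_)
    · have := E_pow_mul_gamma_mem_span (i := i) (j := j) (g := g) 0
      simpa using this
    all_goals
      rw [Submodule.mem_comap, LinearMap.mulRight_apply] at hx ⊢
      rw [mul_assoc]
    · exact hscal _ _ (k_mul_E n q) (exists_k_mul_gamma h hg) hka _ hx
    · exact hscal _ _ (kh_mul_E n q) (exists_kh_mul_gamma h hg hi) hkha _ hx
    · refine hgen _ (fun a => ?_) (fun a => ?_) _ hx
      · rw [← mul_assoc, ← pow_succ']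
        exact E_pow_mul_gamma_mem_span _
      · rw [← mul_assoc, ← pow_succ']
        exact E_pow_mul_alpha_mem_span _
    · refine hgen _ (fun a => ?_) (fun a => ?_) _ hx
      · rcases a with _ | a
        · rw [pow_zero, one_mul, hg.2, beta]
          exact E_pow_mul_alpha_mem_span _
        · rw [F_mul_E_pow_succ_mul_gamma h hi hg]
          exact Q.add_mem (Q.smul_mem _ (E_pow_mul_alpha_mem_span _))
            (Q.smul_mem _ (E_pow_mul_gamma_mem_span _))
      · rcases a with _ | a
        · rw [pow_zero, one_mul, F_mul_alpha h]
          exact Q.zero_mem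
        · rw [F_mul_E_pow_succ_mul_alpha h hi]
          exact Q.smul_mem _ (E_pow_mul_alpha_mem_span _)
  intro y hy
  obtain ⟨x, rfl⟩ := exists_of_mem_leftIdeal hy
  have h1 : x ∈ Q.comap (LinearMap.mulRight K g) := by rw [htop]; trivial
  exact h1

/-- A relation among the vectors of the two chains, up to the kernel of `F ^ s`. -/
theorem chainFam_coeff_eq_zero (hi : 1 ≤ i) (hi2 : 2 * i ≤ n ^ 2) (hg : IsGamma n q i j g) {s : ℕ}
    {c : Fin (n ^ 2) × Fin 2 → K} (hc : F n q ^ s * ∑ p, c p • chainFam i g p = 0)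
    {p : Fin (n ^ 2) × Fin 2} (hp : (p.1 : ℕ) + s < n ^ 2) : c p = 0 := by
  have hpow : ∀ m (x : U n q), (LinearMap.mulLeft K (F n q) ^ m) x = F n q ^ m * x :=
    fun m x => by rw [LinearMap.pow_mulLeft, LinearMap.mulLeft_apply]
  refine coeff_eq_zero_of_chains (T := LinearMap.mulLeft K (F n q)) (N := n ^ 2)
    (x := fun t => E n q ^ (if t = 0 then n ^ 2 - 2 * i else n ^ 2 - 1) * g) ?_ ?_ (s := s) (c := c)
    ?_ hp
  · rw [LinearMap.pow_mulLeft, F_pow, LinearMap.mulLeft_zero_eq_zero]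
  · rw [Fintype.linearIndependent_iff]
    intro d hd
    obtain ⟨a, ha, hav⟩ := exists_F_pow_mul_gamma_eq_alpha h hi hi2 hg
    obtain ⟨b, hb, hbv⟩ := exists_F_pow_mul_gamma_eq_socle h hi hi2 hg
    simp only [Fin.sum_univ_two, hpow, if_true, one_ne_zero, if_false, hav, hbv, smul_smul] at hd
    obtain ⟨h1, h2⟩ := alpha_pair_eq_zero h hi hi2 hd
    intro t
    obtain rfl | rfl : t = 0 ∨ t = 1 := by omega
    · exact (mul_eq_zero.1 h1).resolve_right ha
    · exact (mul_eq_zero.1 h2).resolve_right hb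
  · simpa only [hpow, chainFam] using hc

theorem linearIndependent_chainFam (hi : 1 ≤ i) (hi2 : 2 * i ≤ n ^ 2) (hg : IsGamma n q i j g) :
    LinearIndependent K (chainFam i g) := by
  rw [Fintype.linearIndependent_iff]
  intro c hc p
  exact chainFam_coeff_eq_zero h hi hi2 hg (s := 0) (by rw [hc, mul_zero]) p.1.2

/-- `u γ` is free of rank two over the algebra generated by `F`. -/
theorem leftIdeal_eq_span_chainFam (hi : 1 ≤ i) (hi2 : 2 * i ≤ n ^ 2) (hg : IsGamma n q i j g) :
    (leftIdeal n q g).restrictScalars K = Submodule.span K (Set.range (chainFam i g)) := by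
  have := finite_U h
  have h1 : Submodule.span K (Set.range (chainFam i g)) ≤ (leftIdeal n q g).restrictScalars K := by
    rw [Submodule.span_le]
    rintro _ ⟨p, rfl⟩
    rw [chainFam, ← mul_assoc]
    exact mul_mem_leftIdeal _
  refine (Submodule.eq_of_le_of_finrank_le h1 ?_).symm
  refine (Submodule.finrank_mono (leftIdeal_le_span h hi hg)).trans ?_
  rw [finrank_span_eq_card (linearIndependent_chainFam h hi hi2 hg)]
  refine (finrank_range_le_card _).trans ?_
  simp [mul_comm]

theorem finrank_leftIdeal (hi : 1 ≤ i) (hi2 : 2 * i ≤ n ^ 2) (hg : IsGamma n q i j g) :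
    Module.finrank K (leftIdeal n q g) = 2 * n ^ 2 := by
  change Module.finrank K ((leftIdeal n q g).restrictScalars K) = _
  rw [leftIdeal_eq_span_chainFam h hi hi2 hg,
    finrank_span_eq_card (linearIndependent_chainFam h hi hi2 hg)]
  simp [mul_comm]

theorem exists_of_mem_leftIdeal_of_F_mul_eq_zero (hi : 1 ≤ i) (hi2 : 2 * i ≤ n ^ 2)
    (hg : IsGamma n q i j g) {x : U n q} (hx : x ∈ leftIdeal n q g) (hF : F n q * x = 0) :
    ∃ a b : K, x = a • alpha n q i j + b • (E n q ^ (2 * i - 1) * alpha n q i j) := by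
  have hN := h.one_lt_sq
  have h1 : x ∈ Submodule.span K (Set.range (chainFam i g)) := by
    rw [← leftIdeal_eq_span_chainFam h hi hi2 hg]
    exact hx
  obtain ⟨c, rfl⟩ := (Submodule.mem_span_range_iff_exists_fun K).1 h1
  have h2 := @chainFam_coeff_eq_zero _ _ _ _ h _ _ _ _ hi hi2 hg 1 c (by rw [pow_one, hF])
  obtain ⟨a, -, hav⟩ := exists_F_pow_mul_gamma_eq_alpha h hi hi2 hg
  obtain ⟨b, -, hbv⟩ := exists_F_pow_mul_gamma_eq_socle h hi hi2 hg
  let l : Fin (n ^ 2) := ⟨n ^ 2 - 1, by omega⟩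
  refine ⟨c (l, 0) * a, c (l, 1) * b, ?_⟩
  rw [Fintype.sum_prod_type, Finset.sum_eq_single l]
  · simp only [Fin.sum_univ_two, chainFam, if_true, one_ne_zero, if_false, l, hav, hbv, smul_smul]
  · intro r _ hr
    have hr' : (r : ℕ) + 1 < n ^ 2 := by
      have := r.2
      have : (r : ℕ) ≠ n ^ 2 - 1 := fun h0 => hr (Fin.ext h0)
      omega
    exact Finset.sum_eq_zero fun t _ => by rw [h2 (p := (r, t)) hr', zero_smul]
  · exact fun h0 => absurd (Finset.mem_univ _) h0

theorem alpha_mem_leftIdeal (hi : 1 ≤ i) (hi2 : 2 * i ≤ n ^ 2) (hg : IsGamma n q i j g) :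
    alpha n q i j ∈ leftIdeal n q g := by
  obtain ⟨c, hc, hcv⟩ := exists_F_pow_mul_gamma_eq_alpha h hi hi2 hg
  have h1 : c • alpha n q i j ∈ (leftIdeal n q g).restrictScalars K := by
    rw [← hcv, ← mul_assoc]
    exact mul_mem_leftIdeal _
  exact (Submodule.smul_mem_iff _ hc).1 h1

/-- `E ^ (2 * i - 1) α` lies in every nonzero submodule of `u γ`. -/
theorem socle_generator_mem (hi : 1 ≤ i) (hi2 : 2 * i ≤ n ^ 2) (hg : IsGamma n q i j g)
    {S : Submodule (U n q) (U n q)} (hS : S ≤ leftIdeal n q g) (hS0 : S ≠ ⊥) :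
    E n q ^ (2 * i - 1) * alpha n q i j ∈ S := by
  obtain ⟨x, hxS, hx0⟩ := S.ne_bot_iff.1 hS0
  -- A nonzero vector of `S` that is killed by `F`.
  obtain ⟨y, hyS, hy0, hFy⟩ : ∃ y ∈ S, y ≠ 0 ∧ F n q * y = 0 := by
    have hex : ∃ r, F n q ^ r * x = 0 := ⟨n ^ 2, by rw [F_pow, zero_mul]⟩
    classical
    have h1 : Nat.find hex ≠ 0 := by
      intro h0
      have := Nat.find_spec hex
      rw [h0, pow_zero, one_mul] at this
      exact hx0 this
    refine ⟨F n q ^ (Nat.find hex - 1) * x, S.smul_mem _ hxS, Nat.find_min hex (by omega), ?_⟩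
    rw [← mul_assoc, ← pow_succ', Nat.sub_add_cancel (by omega)]
    exact Nat.find_spec hex
  obtain ⟨a, b, rfl⟩ := exists_of_mem_leftIdeal_of_F_mul_eq_zero h hi hi2 hg (hS hyS) hFy
  have hK : ∀ {c : K} {z : U n q}, c ≠ 0 → c • z ∈ S → z ∈ S := fun hc hz =>
    ((S.restrictScalars K).smul_mem_iff hc).1 hz
  by_cases ha : a = 0
  · subst ha
    rw [zero_smul, zero_add] at hyS hy0
    exact hK (left_ne_zero_of_smul hy0) hyS
  · obtain ⟨c, hc, hc0⟩ := exists_F_pow_mul_alpha h hi hi2 j (2 * i - 1) (n ^ 2 - 2 * i)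
    have h1 := S.smul_mem (F n q ^ (n ^ 2 - 2 * i) * E n q ^ (n ^ 2 - 1)) hyS
    rw [smul_eq_mul, mul_add, mul_smul_comm, mul_smul_comm, mul_assoc, mul_assoc,
      ← mul_assoc (E n q ^ (n ^ 2 - 1)), ← pow_add, E_pow_of_le n q (a := n ^ 2 - 1 + _) (by omega),
      zero_mul, mul_zero, smul_zero, add_zero] at h1
    rw [show 2 * i - 1 + (n ^ 2 - 2 * i) = n ^ 2 - 1 by omega] at hc
    rw [hc, smul_smul] at h1
    exact hK (mul_ne_zero ha (hc0 (by omega) (by omega))) h1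

theorem isSimpleModule_socle (hi : 1 ≤ i) (hi2 : 2 * i ≤ n ^ 2) (hg : IsGamma n q i j g) :
    IsSimpleModule (U n q) (socle (leftIdeal n q g)) := by
  set w := E n q ^ (2 * i - 1) * alpha n q i j with hw
  have hw0 : w ≠ 0 := fun h0 => by
    have := alpha_pair_eq_zero h (j := j) hi hi2 (a := 0) (b := 1) (by
      rw [zero_smul, zero_add, one_smul, ← hw, h0])
    exact one_ne_zero this.2
  have hwP : w ∈ leftIdeal n q g := Submodule.smul_mem _ _ (alpha_mem_leftIdeal h hi hi2 hg)
  have hspan : Submodule.span (U n q) {w} ≤ leftIdeal n q g :=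
    (Submodule.span_singleton_le_iff_mem _ _).2 hwP
  have hatom : IsAtom (Submodule.span (U n q) {w}) := by
    refine ⟨fun h0 => hw0 (Submodule.span_singleton_eq_bot.1 h0), fun S hS => ?_⟩
    by_contra hS0
    exact hS.not_ge ((Submodule.span_singleton_le_iff_mem _ _).2
      (socle_generator_mem h hi hi2 hg (hS.le.trans hspan) hS0))
  have hsoc : socle (leftIdeal n q g) = Submodule.span (U n q) {w} := by
    refine le_antisymm (sSup_le fun S hS => ?_) (le_sSup ⟨isSimpleModule_iff_isAtom.2 hatom, hspan⟩)
    have hS1 := isSimpleModule_iff_isAtom.1 hS.1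
    have h1 : Submodule.span (U n q) {w} ≤ S := (Submodule.span_singleton_le_iff_mem _ _).2
      (socle_generator_mem h hi hi2 hg hS.2 hS1.1)
    exact ((hS1.le_iff_eq hatom.1).1 h1).ge
  rw [hsoc]
  exact isSimpleModule_iff_isAtom.2 hatom

/-! ### The decomposition of `u` -/

variable {γ : ℕ → Fin 2 → U n q}
  (hγ : ∀ i : ℕ, 1 ≤ i → i ≤ n ^ 2 / 2 → ∀ j : Fin 2, IsGamma n q i j (γ i j))

/-- The summand `P E ^ h` of `u` indexed by `t = (i, j, h)`. -/
abbrev summand (γ : ℕ → Fin 2 → U n q) (t : Index n) : Submodule (U n q) (U n q) :=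
  rightTranslate n q (leftIdeal n q (γ t.1.1 t.1.2.1)) (E n q ^ t.1.2.2)

omit h [CharZero K] in
theorem mul_E_pow_mem_iSup_summand (hi : 1 ≤ i) (hi2 : 2 * i ≤ n ^ 2) (j : Fin 2) (x : U n q)
    {b : ℕ} (hb : b ≤ n ^ 2 - 2 * i) : x * γ i j * E n q ^ b ∈ ⨆ t, summand γ t :=
  Submodule.mem_iSup_of_mem (p := summand γ) ⟨(i, j, b), ⟨hi, by omega⟩, hb⟩
    ⟨_, mul_mem_leftIdeal x, rfl⟩

include hγ

/-- The image of the submodule `∑ P E ^ h` under `F ^ (n ^ 2 - 1)` contains that of `u⁰u⁺`. -/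
theorem exists_F_pow_mul_eq (i : ℕ) (j : Fin 2) (b : ℕ) : ∃ m ∈ ⨆ t, summand γ t,
    F n q ^ (n ^ 2 - 1) * m = F n q ^ (n ^ 2 - 1) * (e n q i j * E n q ^ b) := by
  have hM := h.two_mul_half
  have hN := h.one_lt_sq
  by_cases hb : b < n ^ 2
  swap
  · exact ⟨0, zero_mem _, by rw [E_pow_of_le n q (by omega), mul_zero, mul_zero, mul_zero]⟩
  obtain ⟨i₀, h1, h2, hi₀⟩ : ∃ i₀, 1 ≤ i₀ ∧ i₀ ≤ n / 2 * n ∧ e n q i j = e n q i₀ j := by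
    obtain ⟨i', hi'⟩ := exists_e_fin_eq h i j
    rcases Nat.eq_zero_or_pos i' with h0 | h0
    · refine ⟨n / 2 * n, h.half_pos, le_rfl, ?_⟩
      rw [hi', h0, ← zero_add (n / 2 * n), e_add_half h]
    · exact ⟨i', h0, i'.2.le, hi'⟩
  rw [hi₀]
  have hsm : ∀ (c : K) {x : U n q}, x ∈ ⨆ t, summand γ t → c • x ∈ ⨆ t, summand γ t :=
    fun c x hx => ((⨆ t, summand γ t).restrictScalars K).smul_mem c hx
  by_cases hbi : b ≤ n ^ 2 - 2 * i₀
  · obtain ⟨c, hc, hcv⟩ := exists_F_pow_mul_gamma_eq_alpha h h1 (by omega)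
      (hγ i₀ h1 (by omega) j)
    refine ⟨_, hsm c⁻¹ (mul_E_pow_mem_iSup_summand h1 (by omega) j
      (E n q ^ (n ^ 2 - 2 * i₀)) hbi), ?_⟩
    rw [mul_smul_comm, ← mul_assoc, hcv, smul_mul_assoc, smul_smul, inv_mul_cancel₀ hc, one_smul,
      alpha, mul_assoc]
  · -- This vector lies in the socle of the summand for `n ^ 2 / 2 + 1 - i₀` and the other sign.
    set l := n / 2 * n + 1 - i₀ with hl
    have hg := hγ l (by omega) (by omega) (j + 1)
    obtain ⟨c, hc, hcv⟩ := exists_F_pow_mul_gamma_eq_socle h (by omega) (by omega) hg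
    obtain ⟨d, hd, hdv⟩ := exists_E_pow_mul_alpha_eq h (i := l) (by omega) (by omega) (j + 1)
    have hj : j + 1 + 1 = j := by
      obtain rfl | rfl : j = 0 ∨ j = 1 := by omega
      all_goals rfl
    rw [show n / 2 * n + 1 - l = i₀ by omega, hj] at hdv
    refine ⟨_, hsm (c * d)⁻¹ (mul_E_pow_mem_iSup_summand (i := l) (by omega) (by omega) (j + 1)
      (E n q ^ (n ^ 2 - 1)) (b := b - (2 * l - 1)) (by omega)), ?_⟩
    rw [mul_smul_comm, ← mul_assoc, hcv, hdv, smul_smul, smul_mul_assoc, smul_smul,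
      inv_mul_cancel₀ (mul_ne_zero hc hd), one_smul, mul_assoc, mul_assoc, ← pow_add,
      show 2 * l - 1 + (b - (2 * l - 1)) = b by omega]

/-- Nakayama's argument for the nilpotent element `F`: the sum of the summands is `u`, because it is
so modulo `F u`. -/
theorem iSup_summand_eq_top : ⨆ t, summand γ t = ⊤ := by
  set M := ⨆ t, summand γ t with hMdef
  have h1 : ∀ x : U n q, ∃ m ∈ M, ∃ y, m + F n q * y = x := by
    intro x
    have hx : x ∈ layer n q 0 (n ^ 2 - 1) := by rw [layer_eq_top h]; trivial
    have h2 := layer_induction LinearMap.id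
      (M.restrictScalars K ⊔ LinearMap.range (LinearMap.mulLeft K (F n q))) (fun a _ _ i j b => ?_)
        hx
    · obtain ⟨m, hm, _, ⟨y, rfl⟩, hmy⟩ := Submodule.mem_sup.1 h2
      exact ⟨m, hm, y, hmy⟩
    · rcases a with _ | a
      · obtain ⟨m, hm, hmF⟩ := exists_F_pow_mul_eq h hγ i j b
        obtain ⟨y, hy⟩ := exists_F_mul_of_pow_mul_eq_zero h
          (x := e n q i j * E n q ^ b - m) (by rw [mul_sub, hmF, sub_self])
        refine Submodule.mem_sup.2 ⟨m, hm, _, ⟨y, rfl⟩, ?_⟩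
        rw [LinearMap.mulLeft_apply, hy, add_sub_cancel, pow_zero, one_mul]
        rfl
      · refine Submodule.mem_sup_right ⟨F n q ^ a * (e n q i j * E n q ^ b), ?_⟩
        rw [LinearMap.mulLeft_apply, ← mul_assoc, ← pow_succ']
        rfl
  have h2 : ∀ (r : ℕ) (x : U n q), ∃ m ∈ M, ∃ y, m + F n q ^ r * y = x := by
    intro r x
    induction r with
    | zero => exact ⟨0, zero_mem _, x, by simp⟩
    | succ r ih =>
      obtain ⟨m, hm, y, rfl⟩ := ih
      obtain ⟨m', hm', y', rfl⟩ := h1 y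
      exact ⟨m + F n q ^ r * m', add_mem hm (M.smul_mem _ hm'), y', by
        rw [mul_add, ← mul_assoc, ← pow_succ, add_assoc]⟩
  refine eq_top_iff.2 fun x _ => ?_
  obtain ⟨m, hm, y, rfl⟩ := h2 (n ^ 2) x
  rwa [F_pow, zero_mul, add_zero]

omit hγ in
theorem finrank_summand_le (t : Index n)
    (hg : IsGamma n q t.1.1 t.1.2.1 (γ t.1.1 t.1.2.1)) :
    Module.finrank K (summand γ t) ≤ 2 * n ^ 2 := by
  have := finite_U h
  have hN := h.one_lt_sq
  rw [← finrank_leftIdeal h t.2.1.1 (by have := t.2.1.2; omega) hg]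
  exact Submodule.finrank_map_le
    ((LinearMap.toSpanSingleton (U n q) (U n q) (E n q ^ t.1.2.2)).restrictScalars K)
    ((leftIdeal n q (γ t.1.1 t.1.2.1)).restrictScalars K)

omit [Field K] [CharZero K] h hγ in
/-- The triples `(i, j, h)`, with `i` shifted to start at `0`. -/
def indexEquiv (n L : ℕ) (hL : n ^ 2 = 2 * L) :
    Index n ≃ Σ i : Fin L, Fin 2 × Fin (2 * (L - 1 - i) + 1) where
  toFun t := ⟨⟨t.1.1 - 1, by have := t.2; omega⟩, t.1.2.1, ⟨t.1.2.2, by have := t.2; simp; omega⟩⟩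
  invFun s := ⟨(s.1 + 1, s.2.1, s.2.2), by have := s.1.2; have := s.2.2.2; simp; omega⟩
  left_inv t := by
    have := t.2.1.1
    apply Subtype.ext
    refine Prod.ext ?_ rfl
    simp
    omega
  right_inv s := rfl

omit [CharZero K] hγ in
theorem finite_index : Finite (Index n) :=
  Finite.of_equiv _ (indexEquiv n (n / 2 * n) h.two_mul_half.symm).symm

omit [CharZero K] hγ in
theorem card_index [Fintype (Index n)] : Fintype.card (Index n) = 2 * (n / 2 * n) ^ 2 := by
  rw [Fintype.card_congr (indexEquiv n (n / 2 * n) h.two_mul_half.symm), Fintype.card_sigma]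
  simp only [Fintype.card_prod, Fintype.card_fin]
  rw [← Finset.sum_range (fun i => 2 * (2 * (n / 2 * n - 1 - i) + 1)),
    Finset.sum_range_reflect (fun i => 2 * (2 * i + 1))]
  generalize n / 2 * n = L
  induction L with
  | zero => rfl
  | succ L ih => rw [Finset.sum_range_succ, ih]; ring

theorem isInternal_summand : DirectSum.IsInternal (summand γ) := by
  have := finite_U h
  have := finite_index h
  have := Fintype.ofFinite (Index n)
  refine isInternal_of_sum_finrank_le (K := K) (iSup_summand_eq_top h hγ) ?_
  refine (Finset.sum_le_card_nsmul _ _ (2 * n ^ 2) fun t _ =>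
    finrank_summand_le h t (hγ _ t.2.1.1 t.2.1.2 _)).trans ?_
  rw [Finset.card_univ, card_index h, finrank_U h, ← h.two_mul_half, smul_eq_mul]
  exact le_of_eq (by ring)

end Param

end QuasiSl2

theorem theorem2p9 {K : Type*} [Field K] [IsAlgClosed K] [CharZero K] (n : ℕ) (hn : 0 < n)
    (h4 : 4 ∣ n) (q : K) (hq : IsPrimitiveRoot q (n ^ 2)) :
    (∀ i : ℕ, 1 ≤ i → i ≤ n ^ 2 / 2 → ∀ j : Fin 2, ∃! g, QuasiSl2.IsGamma n q i j g) ∧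
    ∀ γ : ℕ → Fin 2 → QuasiSl2.U n q,
      (∀ i : ℕ, 1 ≤ i → i ≤ n ^ 2 / 2 → ∀ j : Fin 2, QuasiSl2.IsGamma n q i j (γ i j)) →
      (∀ i : ℕ, 1 ≤ i → i ≤ n ^ 2 / 2 → ∀ j : Fin 2,
        Module.finrank K (QuasiSl2.leftIdeal n q (γ i j)) = 2 * n ^ 2 ∧
        IsSimpleModule (QuasiSl2.U n q)
          (QuasiSl2.socle (QuasiSl2.leftIdeal n q (γ i j)))) ∧
      DirectSum.IsInternal (fun t : QuasiSl2.Index n =>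
        QuasiSl2.rightTranslate n q (QuasiSl2.leftIdeal n q (γ t.1.1 t.1.2.1))
          (QuasiSl2.E n q ^ t.1.2.2)) := by
  have h : QuasiSl2.IsParam n q := ⟨hn, h4, hq⟩
  refine ⟨fun i hi hi2 j => QuasiSl2.existsUnique_gamma h hi (by omega) j, fun γ hγ =>
    ⟨fun i hi hi2 j => ?_, QuasiSl2.isInternal_summand h hγ⟩⟩
  exact ⟨QuasiSl2.finrank_leftIdeal h hi (by omega) (hγ i hi hi2 j),
    QuasiSl2.isSimpleModule_socle h hi (by omega) (hγ i hi hi2 j)⟩
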